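/- **Setting.** Let $(X,d)$ be a complete metric space and let $\phi:X\to(-\infty,\infty]$ be lower semicontinuous with $D(\phi):=\{x\mid\phi(x)<\infty\}\neq\emptyset$. A minimal geodesic is a curve $\gamma:[0,1]\to X$ with $d(\gamma(s),\gamma(t))=|s-t|\,d(\gamma(0),\gamma(1))$ for all $s,t$. For $\lambda\in\mathbb R$, $\phi$ satisfies the $\lambda$-convexity inequality along $\gamma$ if $$\phi(\gamma(t))\le(1-t)\phi(\gamma(0))+t\phi(\gamma(1))-\tfrac{\lambda}{2}(1-t)t\,d^2(\gamma(0),\gamma(1))\qquad(t\in[0,1]),$$ and $\phi$ is $\lambda$-convex if any two points of $D(\phi)$ are joined by some minimal geodesic along which this holds. For $\tau>0$ put $$\phi_\tau(x):=\inf_{z\in X}\Big\{\phi(z)+\frac{d^2(x,z)}{2\tau}\Big\},\qquad J_\tau(x):=\Big\{z\in X\,\Big|\,\phi(z)+\frac{d^2(x,z)}{2\tau}=\phi_\tau(x)\Big\}.$$ $\phi$ is coercive if there is $\tau_*>0$ such that $\phi_\tau(x)>-\infty$ and $J_\tau(x)\ne\emptyset$ for all $x\in X$ and $\tau\in(0,\tau_*)$.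 Assume one of the following, for some $\lambda\in\mathbb R$. * **Case I.** $(X,d)$ is a CAT(1)-space (any two points are joined by a minimal geodesic, and for all $x,y,z$ with $d(x,y)+d(y,z)+d(z,x)<2\pi$ and every minimal geodesic $\gamma$ from $y$ to $z$, $d(x,\gamma(t))\le d_{\mathbb S^2}(\tilde x,\tilde\gamma(t))$ for all $t\in[0,1]$, where $\tilde x\tilde y\tilde z$ is a comparison triangle in the unit sphere $\mathbb S^2$ and $\tilde\gamma$ is the minimal geodesic from $\tilde y$ to $\tilde z$); $\phi$ is $\lambda$-convex; and $\operatorname{diam}X<\pi/2$ or $\phi$ is coercive. * **Case II.** $\phi$ is coercive, and there are $K\in\mathbb R$ and a family $\Gamma$ of minimal geodesics of $X$ such that: any two points of $D(\phi)$ are joined by a member of $\Gamma$; the $\lambda$-convexity inequality of $\phi$ holds along every $\gamma\in\Gamma$ with endpoints in $D(\phi)$; for all $\gamma\in\Gamma$, $z\in X$ and $t\in[0,1]$, $$d^2(\gamma(t),z)\le(1-t)d^2(\gamma(0),z)+t\,d^2(\gamma(1),z)-\tfrac K2(1-t)t\,d^2(\gamma(0),\gamma(1));$$ and for all $\gamma,\eta\in\Gamma$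 with $\gamma(0)=\eta(0)=:x$ the following limits exist and agree (commutativity): $$\lim_{s\downarrow0}\frac{d^2(\gamma(s),\eta(1))-d^2(x,\eta(1))}{s}=\lim_{t\downarrow0}\frac{d^2(\eta(t),\gamma(1))-d^2(x,\gamma(1))}{t}.$$ A partition $\boldsymbol\tau$ is a sequence $0=t^0<t^1<\cdots$ with $t^k\to\infty$; its mesh is $|\boldsymbol\tau|:=\sup_k(t^k-t^{k-1})$. A discrete solution from $x_0\in D(\phi)$ is a sequence with $x^0=x_0$ and $x^k\in J_{t^k-t^{k-1}}(x^{k-1})$ for $k\ge1$; its interpolation is $\bar x_{\boldsymbol\tau}(0)=x_0$, $\bar x_{\boldsymbol\tau}(t)=x^k$ for $t\in(t^{k-1},t^k]$. **Theorem (unique limits of discrete solutions).** (i) There is $\delta>0$ such that for every partition with $|\boldsymbol\tau|<\delta$ and every $x_0\in D(\phi)$ there is a discrete solution from $x_0$. (ii) For every $x_0\in D(\phi)$ there is exactly one curve $\xi:[0,\infty)\to X$ with $\xi(0)=x_0$ such that, for every sequence of partitions $\boldsymbol\tau_i$ with $|\boldsymbol\tau_i|\to0$ and all choices of associated discrete solutions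 from $x_0$, the interpolations $\bar x_{\boldsymbol\tau_i}$ converge to $\xi$ uniformly on $[0,T]$ for every $T\geq 0$. In particular, $\xi$ does not depend on the partitions or on the discrete solutions. (iii) Put $\mathcal G(t,x_0):=\xi(t)$. Then $\mathcal G$ maps $[0,\infty)\times D(\phi)$ to $D(\phi)$, $t\mapsto\mathcal G(t,x_0)$ is continuous, $\mathcal G(0,x_0)=x_0$, and $\mathcal G(t,\mathcal G(s,x_0))=\mathcal G(s+t,x_0)$ for all $s,t\ge0$ and $x_0\in D(\phi)$. -/

import Mathlib

open Set Filter Topology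
open scoped NNReal ENNReal

noncomputable section

namespace GradFlow

/-- `γ`, restricted to `[0,1]`, is a minimal geodesic of constant speed from `y` to `z` for the
distance function `δ`. Values of `γ` outside `[0,1]` play no role. -/
def IsMinGeodesicFor {Y : Type*} (δ : Y → Y → ℝ) (γ : ℝ → Y) (y z : Y) : Prop :=
  γ 0 = y ∧ γ 1 = z ∧ ∀ s ∈ Icc (0 : ℝ) 1, ∀ t ∈ Icc (0 : ℝ) 1, δ (γ s) (γ t) = |s - t| * δ y z

/-- Minimal geodesics of a metric space. -/
def IsMinGeodesic {X : Type*} [MetricSpace X] (γ : ℝ → X) (y z : X) : Prop :=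
  IsMinGeodesicFor (fun p q : X => dist p q) γ y z

/-- The unit sphere of Euclidean three-space. -/
abbrev S2 : Type := Metric.sphere (0 : EuclideanSpace ℝ (Fin 3)) 1

/-- The intrinsic (angular) distance of the unit sphere. -/
def sphereDist (p q : S2) : ℝ :=
  InnerProductGeometry.angle (p : EuclideanSpace ℝ (Fin 3)) (q : EuclideanSpace ℝ (Fin 3))

/-- CAT(1)-spaces: geodesic spaces whose triangles of perimeter less than `2π` are not thicker
than their comparison triangles in the unit sphere. The comparison triangle `a b c` is unique up
to isometries of the sphere and its side `σ` from `b` to `c` is then unique since `d(y,z) < π`,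
so it does not matter which one is taken. -/
def IsCAT1 (X : Type*) [MetricSpace X] : Prop :=
  (∀ x y : X, ∃ γ : ℝ → X, IsMinGeodesic γ x y) ∧
  ∀ (x y z : X) (γ : ℝ → X),
    dist x y + dist y z + dist z x < 2 * Real.pi → IsMinGeodesic γ y z →
    ∃ (a b c : S2) (σ : ℝ → S2),
      sphereDist a b = dist x y ∧ sphereDist b c = dist y z ∧ sphereDist c a = dist z x ∧
      IsMinGeodesicFor sphereDist σ b c ∧
      ∀ t ∈ Icc (0 : ℝ) 1, dist x (γ t) ≤ sphereDist a (σ t)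

variable {X : Type*}

/-- The proper domain `D(φ)` of a function with values in `(-∞,∞]`. -/
def dom (φ : X → EReal) : Set X := {x | φ x ≠ ⊤}

variable [MetricSpace X]

/-- The inequality of `lam`-convexity of `φ` along the curve `γ`. -/
def ConvexAlong (φ : X → EReal) (lam : ℝ) (γ : ℝ → X) : Prop :=
  ∀ t ∈ Icc (0 : ℝ) 1,
    φ (γ t) ≤ ((1 - t : ℝ) : EReal) * φ (γ 0) + (t : EReal) * φ (γ 1)
      - ((lam / 2 * (1 - t) * t * dist (γ 0) (γ 1) ^ 2 : ℝ) : EReal)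

/-- `lam`-convexity: any two points of the domain are joined by some minimal geodesic along which
the convexity inequality holds. -/
def IsLamConvex (φ : X → EReal) (lam : ℝ) : Prop :=
  ∀ x ∈ dom φ, ∀ y ∈ dom φ, ∃ γ : ℝ → X, IsMinGeodesic γ x y ∧ ConvexAlong φ lam γ

/-- `K`-convexity along `γ` of the squared distance from every point. -/
def SqDistConvexAlong (K : ℝ) (γ : ℝ → X) : Prop :=
  ∀ z : X, ∀ t ∈ Icc (0 : ℝ) 1,
    dist (γ t) z ^ 2 ≤ (1 - t) * dist (γ 0) z ^ 2 + t * dist (γ 1) z ^ 2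
      - K / 2 * (1 - t) * t * dist (γ 0) (γ 1) ^ 2

/-- Commutativity for two geodesics issuing from the same point: both one-sided derivatives of
the squared distance exist, and they agree. -/
def CommutesWith (γ η : ℝ → X) : Prop :=
  ∃ L : ℝ,
    Tendsto (fun s : ℝ => (dist (γ s) (η 1) ^ 2 - dist (γ 0) (η 1) ^ 2) / s) (𝓝[>] 0) (𝓝 L) ∧
    Tendsto (fun t : ℝ => (dist (η t) (γ 1) ^ 2 - dist (η 0) (γ 1) ^ 2) / t) (𝓝[>] 0) (𝓝 L)

/-- The Moreau-Yosida approximation. -/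
def moreauYosida (φ : X → EReal) (τ : ℝ) (x : X) : EReal :=
  ⨅ z : X, (φ z + ((dist x z ^ 2 / (2 * τ) : ℝ) : EReal))

/-- The set of points attaining the infimum in the Moreau-Yosida approximation. -/
def resolventSet (φ : X → EReal) (τ : ℝ) (x : X) : Set X :=
  {z | φ z + ((dist x z ^ 2 / (2 * τ) : ℝ) : EReal) = moreauYosida φ τ x}

/-- Coercivity. -/
def IsCoercive (φ : X → EReal) : Prop :=
  ∃ τs : ℝ, 0 < τs ∧ ∀ τ : ℝ, 0 < τ → τ < τs → ∀ x : X,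
    moreauYosida φ τ x ≠ ⊥ ∧ (resolventSet φ τ x).Nonempty

/-- Case I: a CAT(1)-space and a `lam`-convex function, where either the diameter of the space is
less than `π/2` or the function is coercive. -/
def CaseI (φ : X → EReal) (lam : ℝ) : Prop :=
  IsCAT1 X ∧ IsLamConvex φ lam ∧
    (Metric.ediam (univ : Set X) < ENNReal.ofReal (Real.pi / 2) ∨ IsCoercive φ)

/-- Case II: a coercive function and a family `Γ` of minimal geodesics that joins any two points
of the domain, such that the commutativity, the `K`-convexity of the squared distance and the
`lam`-convexity of `φ` hold along the members of `Γ`. -/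
def CaseII (φ : X → EReal) (lam : ℝ) : Prop :=
  IsCoercive φ ∧ ∃ (K : ℝ) (Γ : Set (ℝ → X)),
    (∀ γ ∈ Γ, IsMinGeodesic γ (γ 0) (γ 1)) ∧
    (∀ x ∈ dom φ, ∀ y ∈ dom φ, ∃ γ ∈ Γ, γ 0 = x ∧ γ 1 = y) ∧
    (∀ γ ∈ Γ, γ 0 ∈ dom φ → γ 1 ∈ dom φ → ConvexAlong φ lam γ) ∧
    (∀ γ ∈ Γ, SqDistConvexAlong K γ) ∧
    (∀ γ ∈ Γ, ∀ η ∈ Γ, γ 0 = η 0 → CommutesWith γ η)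

/-- Partitions `0 = t⁰ < t¹ < ⋯` of `[0,∞)` with `tᵏ → ∞`. -/
structure TimePartition where
  t : ℕ → ℝ
  t_zero : t 0 = 0
  strictMono : StrictMono t
  tendsto : Tendsto t atTop atTop

/-- The mesh `sup_k (tᵏ⁺¹ - tᵏ)`, possibly infinite. -/
def TimePartition.mesh (P : TimePartition) : ℝ≥0∞ :=
  ⨆ k : ℕ, ENNReal.ofReal (P.t (k + 1) - P.t k)

/-- Discrete solutions of the minimizing movement scheme. -/
def IsDiscreteSolution (φ : X → EReal) (P : TimePartition) (x₀ : X) (x : ℕ → X) : Prop :=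
  x 0 = x₀ ∧ ∀ k : ℕ, x (k + 1) ∈ resolventSet φ (P.t (k + 1) - P.t k) (x k)

/-- The piecewise constant interpolation: the value at `s` is `xᵏ` for the least `k` with
`s ≤ tᵏ`. -/
def interp (P : TimePartition) (x : ℕ → X) (s : ℝ≥0) : X :=
  x (sInf {k : ℕ | (s : ℝ) ≤ P.t k})

/-- `ξ` is the locally uniform limit, starting at `x₀`, of every sequence of interpolated discrete
solutions from `x₀` whose meshes tend to zero. -/
def IsLimitCurve (φ : X → EReal) (x₀ : X) (ξ : ℝ≥0 → X) : Prop :=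
  ξ 0 = x₀ ∧
  ∀ (P : ℕ → TimePartition) (x : ℕ → ℕ → X),
    Tendsto (fun i => (P i).mesh) atTop (𝓝 0) →
    (∀ i, IsDiscreteSolution φ (P i) x₀ (x i)) →
    ∀ T : ℝ≥0, TendstoUniformlyOn (fun i => interp (P i) (x i)) ξ atTop (Icc 0 T)

end GradFlow

end

/-!
Let `z` be a resolvent point of `x` and `γ` a geodesic from `z` to `y`. Minimality of `z` against
`γ s` and `λ`-convexity turn an upper bound for the derivative of `dist x (γ s) ^ 2` at `s = 0`
into an estimate of `φ z - φ y`. Both cases bound this derivative by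
`dist x y ^ 2 - dist z y ^ 2 + κ * dist x z ^ 2`: in Case I by comparison with the sphere (with
`κ = 0`, for points within distance `π / 2` of each other), in Case II because commutativity allows
to differentiate along the geodesic from `z` to `x` instead, where the squared distance from `y` is
semiconvex. This is a discrete evolution variational inequality for test points near `x`.

Inserting the values of a second discrete solution as test points, while the two partitions are
traversed together, shows that the squared distance of two discrete solutions, corrected by a small
multiple of their energies, grows at most exponentially. The correction vanishes with the mesh, so
discrete solutions from one starting point are uniformly Cauchy, and their limits depend
continuously on the starting point; the semigroup property follows by restarting the scheme at a
node.

In Case I with `diam X < π / 2` the squared distance is uniformly convex along geodesics, so that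
resolvent points exist for small `τ` as limits of minimizing sequences.
-/

noncomputable section

namespace GradFlow

/-! ### Spherical trigonometry -/

section Spherical

lemma mul_cos_le_sin {x : ℝ} (h0 : 0 ≤ x) (hpi : x ≤ Real.pi) : x * Real.cos x ≤ Real.sin x := by
  rcases lt_or_ge x (Real.pi / 2) with hx | hx
  · have hcos : 0 < Real.cos x := Real.cos_pos_of_mem_Ioo ⟨by linarith [Real.pi_pos], hx⟩
    rw [← le_div_iff₀ hcos, ← Real.tan_eq_sin_div_cos]
    exact Real.le_tan h0 hx
  · have hcos : Real.cos x ≤ 0 :=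
      Real.cos_nonpos_of_pi_div_two_le_of_le hx (by linarith [Real.pi_pos])
    exact (mul_nonpos_of_nonneg_of_nonpos h0 hcos).trans
      (Real.sin_nonneg_of_nonneg_of_le_pi h0 hpi)

lemma mul_sin_le_mul_sin {x y : ℝ} (h0 : 0 ≤ x) (hxy : x ≤ y) (hpi : y ≤ Real.pi) :
    x * Real.sin y ≤ y * Real.sin x := by
  rcases (h0.trans hxy).eq_or_lt with rfl | hy
  · simp [le_antisymm hxy h0]
  · have hconc := strictConcaveOn_sin_Icc.concaveOn.2 (left_mem_Icc.2 Real.pi_nonneg)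
      ⟨hy.le, hpi⟩ (sub_nonneg.2 ((div_le_one hy).2 hxy)) (div_nonneg h0 hy.le)
      (sub_add_cancel 1 (x / y))
    simp only [smul_eq_mul, Real.sin_zero, mul_zero, zero_add, div_mul_cancel₀ x hy.ne'] at hconc
    rwa [div_mul_eq_mul_div, div_le_iff₀ hy, mul_comm (Real.sin x)] at hconc

-- This is the tangent line inequality at `cos b` for the convex function `u ↦ (arccos u) ^ 2`.
lemma two_mul_mul_cos_sub_cos_le {b c : ℝ} (hb : b ∈ Icc 0 Real.pi) (hc : c ∈ Icc 0 Real.pi) :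
    2 * b * (Real.cos b - Real.cos c) ≤ Real.sin b * (c ^ 2 - b ^ 2) := by
  obtain ⟨⟨hb0, hb1⟩, hc0, hc1⟩ := And.intro hb hc
  rcases le_total b c with hbc | hcb
  · obtain ⟨p, q, rfl, rfl⟩ : ∃ p q, b = p - q ∧ c = p + q :=
      ⟨(c + b) / 2, (c - b) / 2, by ring, by ring⟩
    have hq : 0 ≤ q := by linarith
    have hp : 0 ≤ p := by linarith
    have hmono : (p - q) * Real.sin p * Real.sin q ≤ p * Real.sin (p - q) * q :=
      mul_le_mul (mul_sin_le_mul_sin hb0 (by linarith) (by linarith)) (Real.sin_le hq)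
        (Real.sin_nonneg_of_nonneg_of_le_pi hq (by linarith))
        (mul_nonneg hp (Real.sin_nonneg_of_nonneg_of_le_pi hb0 hb1))
    rw [Real.cos_sub, Real.cos_add]
    linarith
  · obtain ⟨p, q, rfl, rfl⟩ : ∃ p q, b = p + q ∧ c = p - q :=
      ⟨(c + b) / 2, (b - c) / 2, by ring, by ring⟩
    have hq : 0 ≤ q := by linarith
    have hp : 0 ≤ p := by linarith
    have hsp := Real.sin_nonneg_of_nonneg_of_le_pi hp (by linarith)
    have hsq := Real.sin_nonneg_of_nonneg_of_le_pi hq (by linarith)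
    have hqcos := mul_le_mul_of_nonneg_left (mul_cos_le_sin hq (by linarith)) (mul_nonneg hp hsp)
    have hpcos := mul_le_mul_of_nonneg_left (mul_cos_le_sin hp (by linarith)) (mul_nonneg hq hsq)
    rw [Real.cos_sub, Real.cos_add, Real.sin_add]
    linarith

lemma two_mul_mul_cos_mul_cos_sub_cos_le {a b c : ℝ} (ha : a ∈ Icc 0 Real.pi)
    (hb : b ∈ Icc 0 (Real.pi / 2)) (hc : c ∈ Icc 0 (Real.pi / 2)) :
    2 * a * b * (Real.cos a * Real.cos b - Real.cos c) ≤
      Real.sin a * Real.sin b * (c ^ 2 - b ^ 2) := by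
  have hpi := Real.pi_pos
  have hcosb : 0 ≤ Real.cos b := Real.cos_nonneg_of_mem_Icc ⟨by linarith [hb.1], hb.2⟩
  have hcosc : 0 ≤ Real.cos c := Real.cos_nonneg_of_mem_Icc ⟨by linarith [hc.1], hc.2⟩
  have hb' : b ∈ Icc 0 Real.pi := ⟨hb.1, by linarith [hb.2]⟩
  have hc' : c ∈ Icc 0 Real.pi := ⟨hc.1, by linarith [hc.2]⟩
  calc 2 * a * b * (Real.cos a * Real.cos b - Real.cos c)
      = 2 * (b * Real.cos b) * (a * Real.cos a) - 2 * (b * Real.cos c) * a := by ring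
    _ ≤ 2 * (b * Real.cos b) * Real.sin a - 2 * (b * Real.cos c) * Real.sin a := by
        have := mul_nonneg hb.1 hcosb
        have := mul_nonneg hb.1 hcosc
        gcongr
        exacts [mul_cos_le_sin ha.1 ha.2, Real.sin_le ha.1]
    _ = Real.sin a * (2 * b * (Real.cos b - Real.cos c)) := by ring
    _ ≤ Real.sin a * (Real.sin b * (c ^ 2 - b ^ 2)) :=
        mul_le_mul_of_nonneg_left (two_mul_mul_cos_sub_cos_le hb' hc')
          (Real.sin_nonneg_of_nonneg_of_le_pi ha.1 ha.2)
    _ = Real.sin a * Real.sin b * (c ^ 2 - b ^ 2) := by ring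

section UnitVectors

variable {E : Type*} [NormedAddCommGroup E] [InnerProductSpace ℝ E]

lemma sin_add_smul_eq_of_inner_eq_cos {p q w : E} {u v : ℝ} (hp : ‖p‖ = 1) (hq : ‖q‖ = 1)
    (hw : ‖w‖ = 1) (hpq : inner ℝ p q = Real.cos (u + v)) (hpw : inner ℝ p w = Real.cos u)
    (hwq : inner ℝ w q = Real.cos v) :
    Real.sin (u + v) • w = Real.sin v • p + Real.sin u • q := by
  have hpp : inner ℝ p p = (1 : ℝ) := by rw [real_inner_self_eq_norm_sq, hp, one_pow]
  have hqq : inner ℝ q q = (1 : ℝ) := by rw [real_inner_self_eq_norm_sq, hq, one_pow]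
  have hww : inner ℝ w w = (1 : ℝ) := by rw [real_inner_self_eq_norm_sq, hw, one_pow]
  rw [← sub_eq_zero, ← inner_self_eq_zero (𝕜 := ℝ)]
  simp only [inner_sub_left, inner_sub_right, inner_add_left, inner_add_right,
    real_inner_smul_left, real_inner_smul_right, real_inner_comm p w, real_inner_comm w q,
    real_inner_comm p q, hpp, hqq, hww, hpq, hpw, hwq, Real.sin_add, Real.cos_add]
  have hu : Real.cos u ^ 2 = 1 - Real.sin u ^ 2 := by linarith [Real.sin_sq_add_cos_sq u]
  have hv : Real.cos v ^ 2 = 1 - Real.sin v ^ 2 := by linarith [Real.sin_sq_add_cos_sq v]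
  ring_nf
  simp only [hu, hv]
  ring

end UnitVectors

lemma inner_eq_cos_sphereDist (p q : S2) :
    inner ℝ (p : EuclideanSpace ℝ (Fin 3)) (q : EuclideanSpace ℝ (Fin 3)) =
      Real.cos (sphereDist p q) :=
  InnerProductGeometry.inner_eq_cos_angle_of_norm_eq_one (norm_eq_of_mem_sphere p)
    (norm_eq_of_mem_sphere q)

namespace IsMinGeodesicFor

variable {Y : Type*} {δ : Y → Y → ℝ} {γ : ℝ → Y} {y z : Y}

lemma left_apply (hγ : IsMinGeodesicFor δ γ y z) {t : ℝ} (ht : t ∈ Icc (0 : ℝ) 1) :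
    δ y (γ t) = t * δ y z := by
  rw [← hγ.1, hγ.2.2 0 (left_mem_Icc.2 zero_le_one) t ht, zero_sub, abs_neg, abs_of_nonneg ht.1,
    hγ.1]

lemma apply_right (hγ : IsMinGeodesicFor δ γ y z) {t : ℝ} (ht : t ∈ Icc (0 : ℝ) 1) :
    δ (γ t) z = (1 - t) * δ y z := by
  rw [← hγ.2.1, hγ.2.2 t ht 1 (right_mem_Icc.2 zero_le_one), abs_sub_comm,
    abs_of_nonneg (sub_nonneg.2 ht.2), hγ.2.1]

end IsMinGeodesicFor

variable {X : Type*} [MetricSpace X]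

/-- The comparison inequality of CAT(1)-spaces, freed from the model space. -/
lemma IsCAT1.sin_mul_cos_dist_ge (hX : IsCAT1 X) {x y z : X} {γ : ℝ → X}
    (hper : dist x y + dist y z + dist z x < 2 * Real.pi) (hγ : IsMinGeodesic γ y z) {t : ℝ}
    (ht : t ∈ Icc (0 : ℝ) 1) :
    Real.sin ((1 - t) * dist y z) * Real.cos (dist x y)
        + Real.sin (t * dist y z) * Real.cos (dist x z) ≤
      Real.sin (dist y z) * Real.cos (dist x (γ t)) := by
  obtain ⟨a, b, c, σ, hab, hbc, hca, hσ, hle⟩ := hX.2 x y z γ hper hγ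
  have hac : sphereDist a c = dist x z := by
    rw [dist_comm, ← hca, sphereDist, sphereDist, InnerProductGeometry.angle_comm]
  have hyz : dist y z ≤ Real.pi := by
    linarith [dist_triangle y x z, dist_comm y x, dist_comm x z]
  have harc : Real.sin (dist y z) • (σ t : EuclideanSpace ℝ (Fin 3)) =
      Real.sin ((1 - t) * dist y z) • (b : EuclideanSpace ℝ (Fin 3))
        + Real.sin (t * dist y z) • (c : EuclideanSpace ℝ (Fin 3)) := by
    have hsum : t * dist y z + (1 - t) * dist y z = dist y z := by ring
    have hbσ := hσ.left_apply ht
    have hσc := hσ.apply_right ht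
    rw [hbc] at hbσ hσc
    have := sin_add_smul_eq_of_inner_eq_cos (u := t * dist y z) (v := (1 - t) * dist y z)
      (norm_eq_of_mem_sphere b) (norm_eq_of_mem_sphere c) (norm_eq_of_mem_sphere (σ t))
      (by rw [inner_eq_cos_sphereDist, hbc, hsum]) (by rw [inner_eq_cos_sphereDist, hbσ])
      (by rw [inner_eq_cos_sphereDist, hσc])
    rwa [hsum] at this
  have hinner := congrArg (fun v => inner ℝ (a : EuclideanSpace ℝ (Fin 3)) v) harc
  simp only [inner_add_right, real_inner_smul_right, inner_eq_cos_sphereDist, hab, hac] at hinner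
  rw [← hinner]
  exact mul_le_mul_of_nonneg_left
    (Real.cos_le_cos_of_nonneg_of_le_pi dist_nonneg (InnerProductGeometry.angle_le_pi _ _)
      (hle t ht))
    (Real.sin_nonneg_of_nonneg_of_le_pi dist_nonneg hyz)

end Spherical

/-! ### The discrete evolution variational inequality -/

section EvolutionInequality

/-- The real value of `φ` at the points of its domain; elsewhere it is a junk value. -/
def energy {X : Type*} (φ : X → EReal) (x : X) : ℝ := (φ x).toReal

variable {X : Type*}

lemma coe_energy {φ : X → EReal} (hbot : ∀ x, φ x ≠ ⊥) {x : X} (hx : x ∈ dom φ) :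
    ((energy φ x : ℝ) : EReal) = φ x :=
  EReal.coe_toReal hx (hbot x)

lemma le_coe_iff_mem_dom_and_energy_le {φ : X → EReal} (hbot : ∀ x, φ x ≠ ⊥) {x : X} {C : ℝ} :
    φ x ≤ C ↔ x ∈ dom φ ∧ energy φ x ≤ C := by
  refine ⟨fun h => ?_, fun ⟨hx, hC⟩ => ?_⟩
  · have hx : x ∈ dom φ := ne_top_of_le_ne_top (EReal.coe_ne_top C) h
    rw [← coe_energy hbot hx] at h
    exact ⟨hx, EReal.coe_le_coe_iff.1 h⟩
  · rw [← coe_energy hbot hx]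
    exact EReal.coe_le_coe_iff.2 hC

variable [MetricSpace X]

lemma moreauYosida_le (φ : X → EReal) (τ : ℝ) (x w : X) :
    moreauYosida φ τ x ≤ φ w + ((dist x w ^ 2 / (2 * τ) : ℝ) : EReal) :=
  iInf_le (fun z => φ z + ((dist x z ^ 2 / (2 * τ) : ℝ) : EReal)) w

lemma mem_dom_of_mem_resolventSet {φ : X → EReal} {τ : ℝ} {x z : X}
    (hx : x ∈ dom φ) (hz : z ∈ resolventSet φ τ x) : z ∈ dom φ := by
  intro htop
  have hle := (show _ = _ from hz).trans_le (moreauYosida_le φ τ x x)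
  rw [htop, EReal.top_add_coe, dist_self, top_le_iff] at hle
  exact EReal.add_ne_top hx (EReal.coe_ne_top _) hle

lemma energy_add_le_of_mem_resolventSet {φ : X → EReal} (hbot : ∀ x, φ x ≠ ⊥) {τ : ℝ} {x z w : X}
    (hz : z ∈ resolventSet φ τ x) (hx : x ∈ dom φ) (hw : w ∈ dom φ) :
    energy φ z + dist x z ^ 2 / (2 * τ) ≤ energy φ w + dist x w ^ 2 / (2 * τ) := by
  have hle := (show _ = _ from hz).trans_le (moreauYosida_le φ τ x w)
  rw [← coe_energy hbot hw, ← coe_energy hbot (mem_dom_of_mem_resolventSet hx hz)] at hle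
  exact_mod_cast hle

lemma ConvexAlong.mem_dom_and_energy_le {φ : X → EReal} (hbot : ∀ x, φ x ≠ ⊥) {lam : ℝ}
    {γ : ℝ → X} (h : ConvexAlong φ lam γ) (h0 : γ 0 ∈ dom φ) (h1 : γ 1 ∈ dom φ) {t : ℝ}
    (ht : t ∈ Icc (0 : ℝ) 1) :
    γ t ∈ dom φ ∧ energy φ (γ t) ≤ (1 - t) * energy φ (γ 0) + t * energy φ (γ 1)
      - lam / 2 * (1 - t) * t * dist (γ 0) (γ 1) ^ 2 := by
  rw [← le_coe_iff_mem_dom_and_energy_le hbot]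
  have hconv := h t ht
  rw [← coe_energy hbot h0, ← coe_energy hbot h1] at hconv
  exact_mod_cast hconv

/-- The upper right derivative at `0` of the squared distance from `x` along `γ` is at most `M`. -/
def FirstVariationLE (x : X) (γ : ℝ → X) (M : ℝ) : Prop :=
  ∀ u, M < u → ∀ᶠ s in 𝓝[>] (0 : ℝ), dist x (γ s) ^ 2 ≤ dist x (γ 0) ^ 2 + s * u

lemma eventually_nhdsGT_mem_Ioc : ∀ᶠ s : ℝ in 𝓝[>] 0, s ∈ Ioc (0 : ℝ) 1 :=
  Ioc_mem_nhdsGT zero_lt_one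

lemma FirstVariationLE.of_tendsto {x : X} {γ : ℝ → X} {U : ℝ → ℝ} {L M : ℝ}
    (hU : Tendsto U (𝓝[>] 0) (𝓝 L)) (hLM : L ≤ M)
    (hle : ∀ᶠ s in 𝓝[>] 0, dist x (γ s) ^ 2 ≤ dist x (γ 0) ^ 2 + s * U s) :
    FirstVariationLE x γ M := by
  intro u hu
  filter_upwards [hle, hU.eventually_lt_const (hLM.trans_lt hu), eventually_nhdsGT_mem_Ioc]
    with s hs hUs hs0
  have := mul_le_mul_of_nonneg_left hUs.le hs0.1.le
  linarith

lemma FirstVariationLE.le_of_tendsto {x : X} {γ : ℝ → X} {c : ℝ → ℝ} {C M : ℝ}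
    (h : FirstVariationLE x γ M) (hc : Tendsto c (𝓝[>] 0) (𝓝 C))
    (hle : ∀ᶠ s in 𝓝[>] 0, dist x (γ 0) ^ 2 + s * c s ≤ dist x (γ s) ^ 2) : C ≤ M := by
  refine le_of_forall_gt_imp_ge_of_dense fun u hu => ?_
  refine _root_.le_of_tendsto hc ?_
  filter_upwards [h u hu, hle, eventually_nhdsGT_mem_Ioc] with s hs hcs hs0
  exact le_of_mul_le_mul_left (by linarith) hs0.1

lemma FirstVariationLE.mono {x : X} {γ : ℝ → X} {M M' : ℝ} (h : FirstVariationLE x γ M)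
    (hM : M ≤ M') : FirstVariationLE x γ M' :=
  fun u hu => h u (hM.trans_lt hu)

/-- Minimality of the resolvent point `γ 0` against `γ s`, as `s → 0`. -/
lemma two_mul_energy_sub_le_of_firstVariationLE {φ : X → EReal} (hbot : ∀ x, φ x ≠ ⊥)
    {lam τ M : ℝ} (hτ : 0 < τ) {x : X} {γ : ℝ → X} (hx : x ∈ dom φ)
    (h0 : γ 0 ∈ resolventSet φ τ x) (h1 : γ 1 ∈ dom φ) (hγ : ConvexAlong φ lam γ)
    (hM : FirstVariationLE x γ M) :
    2 * τ * (energy φ (γ 0) - energy φ (γ 1) + lam / 2 * dist (γ 0) (γ 1) ^ 2) ≤ M := by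
  have hcont : Continuous fun s : ℝ =>
      2 * τ * (energy φ (γ 0) - energy φ (γ 1) + lam / 2 * (1 - s) * dist (γ 0) (γ 1) ^ 2) := by
    fun_prop
  refine hM.le_of_tendsto ((hcont.tendsto' 0 _ (by simp)).mono_left nhdsWithin_le_nhds) ?_
  filter_upwards [eventually_nhdsGT_mem_Ioc] with s hs
  obtain ⟨hγs, hconv⟩ :=
    hγ.mem_dom_and_energy_le hbot (mem_dom_of_mem_resolventSet hx h0) h1 ⟨hs.1.le, hs.2⟩
  have hmin := energy_add_le_of_mem_resolventSet hbot h0 hx hγs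
  have hquot : dist x (γ 0) ^ 2 / (2 * τ) + s * (energy φ (γ 0) - energy φ (γ 1)
      + lam / 2 * (1 - s) * dist (γ 0) (γ 1) ^ 2) ≤ dist x (γ s) ^ 2 / (2 * τ) := by
    linarith
  rw [le_div_iff₀ (by positivity), add_mul, div_mul_cancel₀ _ (by positivity)] at hquot
  linarith

/-- The discrete evolution variational inequality for a resolvent point `z` of `x` and a test
point `y`, both within distance `r` of `x`. -/
def LocalEVI (φ : X → EReal) (l κ r : ℝ) : Prop :=
  ∀ τ : ℝ, 0 < τ → ∀ x ∈ dom φ, ∀ z ∈ resolventSet φ τ x, ∀ y ∈ dom φ,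
    dist x y < r → dist x z < r →
    dist z y ^ 2 ≤ dist x y ^ 2 + l * τ * dist z y ^ 2 + 2 * τ * (energy φ y - energy φ z)
      + κ * dist x z ^ 2

/-- The common conclusion drawn from the geometric hypotheses of both cases; all that the
convergence of the scheme needs besides coercivity. -/
def HasLocalEVI (φ : X → EReal) : Prop :=
  ∃ l κ r : ℝ, 0 ≤ l ∧ 0 ≤ κ ∧ 0 < r ∧ LocalEVI φ l κ r

lemma LocalEVI.of_firstVariationLE {φ : X → EReal} (hbot : ∀ x, φ x ≠ ⊥) {lam κ r : ℝ}
    (h : ∀ x ∈ dom φ, ∀ z ∈ dom φ, ∀ y ∈ dom φ, dist x y < r → dist x z < r →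
      ∃ γ : ℝ → X, γ 0 = z ∧ γ 1 = y ∧ ConvexAlong φ lam γ ∧
        FirstVariationLE x γ (dist x y ^ 2 - dist z y ^ 2 + κ * dist x z ^ 2)) :
    LocalEVI φ |lam| κ r := by
  intro τ hτ x hx z hz y hy hxy hxz
  obtain ⟨γ, rfl, rfl, hconv, hvar⟩ :=
    h x hx z (mem_dom_of_mem_resolventSet hx hz) y hy hxy hxz
  have hmin := two_mul_energy_sub_le_of_firstVariationLE hbot hτ hx hz hy hconv hvar
  have hlam := mul_le_mul_of_nonneg_right (neg_abs_le lam)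
    (mul_nonneg hτ.le (sq_nonneg (dist (γ 0) (γ 1))))
  linarith

lemma CommutesWith.firstVariationLE {γ η : ℝ → X} {K : ℝ} (h : CommutesWith γ η)
    (hη : SqDistConvexAlong K η) (h0 : γ 0 = η 0) :
    FirstVariationLE (η 1) γ
      (dist (η 1) (γ 1) ^ 2 - dist (γ 0) (γ 1) ^ 2 - K / 2 * dist (η 1) (γ 0) ^ 2) := by
  obtain ⟨L, hγL, hηL⟩ := h
  refine FirstVariationLE.of_tendsto hγL ?_ ?_
  · have hcont : Continuous fun t : ℝ => dist (η 1) (γ 1) ^ 2 - dist (γ 0) (γ 1) ^ 2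
        - K / 2 * (1 - t) * dist (η 1) (γ 0) ^ 2 := by
      fun_prop
    refine le_of_tendsto_of_tendsto hηL
      ((hcont.tendsto' 0 _ (by simp)).mono_left nhdsWithin_le_nhds) ?_
    filter_upwards [eventually_nhdsGT_mem_Ioc] with t ht
    have hconv := hη (γ 1) t ⟨ht.1.le, ht.2⟩
    rw [div_le_iff₀ ht.1, h0, dist_comm (η 1) (η 0)]
    linarith
  · filter_upwards [eventually_nhdsGT_mem_Ioc] with s hs
    rw [mul_div_cancel₀ _ hs.1.ne', dist_comm (η 1), dist_comm (η 1)]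
    linarith

lemma IsMinGeodesic.tendsto_nhdsGT_zero {γ : ℝ → X} {y z : X} (h : IsMinGeodesic γ y z) :
    Tendsto γ (𝓝[>] 0) (𝓝 y) := by
  have hcont : Continuous fun s : ℝ => s * dist y z := by fun_prop
  rw [tendsto_iff_dist_tendsto_zero]
  refine ((hcont.tendsto' 0 0 (by simp)).mono_left nhdsWithin_le_nhds).congr' ?_
  filter_upwards [eventually_nhdsGT_mem_Ioc] with s hs
  exact ((dist_comm (γ s) y).trans (h.left_apply ⟨hs.1.le, hs.2⟩)).symm

/-- The slope at `s = 0` of the right-hand side of the spherical comparison inequality. -/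
lemma tendsto_sin_slope (a b c : ℝ) :
    Tendsto (fun s : ℝ => s⁻¹ * ((Real.sin b - Real.sin ((1 - s) * b)) * Real.cos a
      - Real.sin (s * b) * Real.cos c)) (𝓝[>] 0)
      (𝓝 (b * (Real.cos a * Real.cos b - Real.cos c))) := by
  have hleft : HasDerivAt (fun s : ℝ => (1 - s) * b) (-b) 0 := by
    simpa using ((hasDerivAt_id (0 : ℝ)).const_sub 1).mul_const b
  have hright : HasDerivAt (fun s : ℝ => s * b) b 0 := by
    simpa using (hasDerivAt_id (0 : ℝ)).mul_const b
  have hslope := (((hleft.sin.const_sub (Real.sin b)).mul_const (Real.cos a)).sub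
    (hright.sin.mul_const (Real.cos c))).tendsto_slope_zero_right
  simp only [zero_add, sub_zero, one_mul, zero_mul, Real.cos_zero, Real.sin_zero, sub_self,
    smul_eq_mul, Pi.sub_apply] at hslope
  convert hslope using 2
  ring

lemma IsCAT1.sq_dist_le_add_sin_slope (hX : IsCAT1 X) {x z y : X} {γ : ℝ → X}
    (hγ : IsMinGeodesic γ z y) (hper : dist x z + dist z y + dist y x < 2 * Real.pi)
    (hxz : dist x z ≤ Real.pi) (hzy : 0 < Real.sin (dist z y)) {s : ℝ} (hs : s ∈ Ioc (0 : ℝ) 1)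
    (hxs : 0 < Real.sin (dist x (γ s))) (hxs' : dist x (γ s) ≤ Real.pi) :
    dist x (γ s) ^ 2 ≤ dist x z ^ 2 + s * (2 * dist x (γ s) *
      (s⁻¹ * ((Real.sin (dist z y) - Real.sin ((1 - s) * dist z y)) * Real.cos (dist x z)
        - Real.sin (s * dist z y) * Real.cos (dist x y))) /
      (Real.sin (dist x (γ s)) * Real.sin (dist z y))) := by
  have htangent := mul_le_mul_of_nonneg_left
    (two_mul_mul_cos_sub_cos_le ⟨dist_nonneg, hxs'⟩ ⟨dist_nonneg, hxz⟩) hzy.le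
  have hcomp := mul_le_mul_of_nonneg_left (hX.sin_mul_cos_dist_ge hper hγ ⟨hs.1.le, hs.2⟩)
    (mul_nonneg zero_le_two (dist_nonneg (x := x) (y := γ s)))
  rw [← sub_le_iff_le_add', mul_div_assoc', le_div_iff₀ (mul_pos hxs hzy),
    mul_left_comm s, mul_inv_cancel_left₀ hs.1.ne']
  linarith

lemma IsCAT1.firstVariationLE (hX : IsCAT1 X) {x z y : X} {γ : ℝ → X} (hγ : IsMinGeodesic γ z y)
    (hxz : dist x z < Real.pi / 2) (hxy : dist x y < Real.pi / 2) (hzy : dist z y < Real.pi / 2) :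
    FirstVariationLE x γ (dist x y ^ 2 - dist z y ^ 2) := by
  rcases eq_or_ne x z with rfl | hne
  · have hcont : Continuous fun s : ℝ => s * dist x y ^ 2 := by fun_prop
    refine .of_tendsto ((hcont.tendsto' 0 0 (by simp)).mono_left nhdsWithin_le_nhds)
      (sub_self _).ge ?_
    filter_upwards [eventually_nhdsGT_mem_Ioc] with s hs
    have hdist : dist x (γ s) = s * dist x y := hγ.left_apply ⟨hs.1.le, hs.2⟩
    rw [hγ.1, hdist, dist_self]
    linarith
  rcases eq_or_ne z y with rfl | hne'
  · refine .of_tendsto (U := fun _ => 0) tendsto_const_nhds (by simp) ?_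
    filter_upwards [eventually_nhdsGT_mem_Ioc] with s hs
    have hdist : dist z (γ s) = s * dist z z := hγ.left_apply ⟨hs.1.le, hs.2⟩
    rw [dist_self, mul_zero, dist_eq_zero] at hdist
    rw [hγ.1, ← hdist, mul_zero, add_zero]
  have hpi := Real.pi_pos
  have hsin {p q : X} (hpq : p ≠ q) (h : dist p q < Real.pi / 2) : 0 < Real.sin (dist p q) :=
    Real.sin_pos_of_pos_of_lt_pi (dist_pos.2 hpq) (by linarith)
  have hmem {p q : X} (h : dist p q < Real.pi / 2) : dist p q ∈ Icc 0 (Real.pi / 2) :=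
    ⟨dist_nonneg, h.le⟩
  have hden := mul_pos (hsin hne hxz) (hsin hne' hzy)
  have hD : Tendsto (fun s => dist x (γ s)) (𝓝[>] 0) (𝓝 (dist x z)) :=
    tendsto_const_nhds.dist hγ.tendsto_nhdsGT_zero
  refine .of_tendsto (((hD.const_mul 2).mul (tendsto_sin_slope (dist x z) (dist z y)
    (dist x y))).div ((Real.continuous_sin.tendsto _ |>.comp hD).mul_const
    (Real.sin (dist z y))) hden.ne') ?_ ?_
  · rw [div_le_iff₀ hden]
    linarith [two_mul_mul_cos_mul_cos_sub_cos_le ⟨dist_nonneg, (by linarith : dist x z ≤ Real.pi)⟩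
      (hmem hzy) (hmem hxy)]
  · filter_upwards [eventually_nhdsGT_mem_Ioc, hD.eventually_lt_const hxz,
      hD.eventually_const_lt (dist_pos.2 hne)] with s hs hxs hxs0
    rw [hγ.1]
    exact hX.sq_dist_le_add_sin_slope hγ (by linarith [dist_comm y x]) (by linarith)
      (hsin hne' hzy) hs (hsin (dist_pos.1 hxs0) hxs) (by linarith)

lemma IsCAT1.hasLocalEVI (hX : IsCAT1 X) {φ : X → EReal} (hbot : ∀ x, φ x ≠ ⊥) {lam : ℝ}
    (hφ : IsLamConvex φ lam) : HasLocalEVI φ := by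
  refine ⟨|lam|, 0, Real.pi / 4, abs_nonneg lam, le_rfl, by positivity,
    .of_firstVariationLE hbot fun x _ z hz y hy hxy hxz => ?_⟩
  obtain ⟨γ, hγ, hconv⟩ := hφ z hz y hy
  have hpi := Real.pi_pos
  refine ⟨γ, hγ.1, hγ.2.1, hconv, ?_⟩
  rw [zero_mul, add_zero]
  exact hX.firstVariationLE hγ (by linarith) (by linarith)
    (by linarith [dist_triangle_left z y x])

lemma CaseII.hasLocalEVI {φ : X → EReal} (hbot : ∀ x, φ x ≠ ⊥) {lam : ℝ} (h : CaseII φ lam) :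
    HasLocalEVI φ := by
  obtain ⟨-, K, Γ, -, hjoin, hconv, hsq, hcomm⟩ := h
  refine ⟨|lam|, |K| / 2, 1, abs_nonneg lam, by positivity, one_pos,
    .of_firstVariationLE hbot fun x hx z hz y hy _ _ => ?_⟩
  obtain ⟨γ, hγ, rfl, rfl⟩ := hjoin z hz y hy
  obtain ⟨η, hη, hη0, rfl⟩ := hjoin (γ 0) hz x hx
  refine ⟨γ, rfl, rfl, hconv γ hγ hz hy,
    ((hcomm γ hγ η hη hη0.symm).firstVariationLE (hsq η hη) hη0.symm).mono ?_⟩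
  have := mul_le_mul_of_nonneg_right (neg_abs_le K) (sq_nonneg (dist (η 1) (γ 0)))
  linarith

end EvolutionInequality

/-! ### Coercivity on CAT(1)-spaces of small diameter -/

section Coercivity

lemma isClosed_setOf_energy_add_le {X : Type*} [TopologicalSpace X] {φ : X → EReal}
    (hbot : ∀ x, φ x ≠ ⊥) (hlsc : LowerSemicontinuous φ) {g : X → ℝ} (hg : Continuous g) (C : ℝ) :
    IsClosed {w | w ∈ dom φ ∧ energy φ w + g w ≤ C} := by
  have hset : {w | w ∈ dom φ ∧ energy φ w + g w ≤ C} =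
      (fun w => (w, ((C - g w : ℝ) : EReal))) ⁻¹' {p | φ p.1 ≤ p.2} := by
    ext w
    simp only [mem_ofPred_eq, mem_preimage, le_coe_iff_mem_dom_and_energy_le hbot,
      le_sub_iff_add_le]
  rw [hset]
  exact hlsc.isClosed_epigraph.preimage
    (continuous_id.prodMk (continuous_coe_real_ereal.comp (continuous_const.sub hg)))

variable {X : Type*} [MetricSpace X]

/-- Uniform convexity makes minimizing sequences Cauchy. -/
lemma exists_isMinOn_of_midpoint_convex [CompleteSpace X] {D : Set X} {Ψ : X → ℝ} {c : ℝ}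
    (hD : D.Nonempty) (hc : 0 < c) (hbdd : BddBelow (Ψ '' D))
    (hclosed : ∀ C, IsClosed {w | w ∈ D ∧ Ψ w ≤ C})
    (hmid : ∀ y ∈ D, ∀ z ∈ D, ∃ w ∈ D, Ψ w + c * dist y z ^ 2 ≤ (Ψ y + Ψ z) / 2) :
    ∃ v ∈ D, IsMinOn Ψ D v := by
  have hinf {w : X} (hw : w ∈ D) : sInf (Ψ '' D) ≤ Ψ w := csInf_le hbdd (mem_image_of_mem Ψ hw)
  obtain ⟨u, hu_anti, hu_pos, hu⟩ := exists_seq_strictAnti_tendsto (0 : ℝ)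
  have hmin (n : ℕ) : ∃ w ∈ D, Ψ w ≤ sInf (Ψ '' D) + u n := by
    obtain ⟨_, ⟨w, hw, rfl⟩, hlt⟩ :=
      exists_lt_of_csInf_lt (hD.image Ψ) (lt_add_of_pos_right _ (hu_pos n))
    exact ⟨w, hw, hlt.le⟩
  choose w hwD hw using hmin
  have hsub {n N : ℕ} (h : N ≤ n) : Ψ (w n) ≤ sInf (Ψ '' D) + u N :=
    (hw n).trans (add_le_add_right (hu_anti.antitone h) _)
  have hcauchy : CauchySeq w := by
    refine cauchySeq_of_le_tendsto_0 (fun N => √(u N / c)) (fun n m N hn hm => ?_) ?_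
    · obtain ⟨v, hv, hle⟩ := hmid _ (hwD n) _ (hwD m)
      refine Real.le_sqrt_of_sq_le ((le_div_iff₀' hc).2 ?_)
      linarith [hinf hv, hsub hn, hsub hm]
    · simpa using (hu.div_const c).sqrt
  obtain ⟨v, hv⟩ := cauchySeq_tendsto_of_complete hcauchy
  have hlim (N : ℕ) : v ∈ D ∧ Ψ v ≤ sInf (Ψ '' D) + u N :=
    (hclosed _).mem_of_tendsto hv ((eventually_ge_atTop N).mono fun n hn => ⟨hwD n, hsub hn⟩)
  have hvinf : Ψ v ≤ sInf (Ψ '' D) :=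
    ge_of_tendsto' (by simpa using hu.const_add (sInf (Ψ '' D))) fun N => (hlim N).2
  exact ⟨v, (hlim 0).1, fun z hz => hvinf.trans (hinf hz)⟩

lemma moreauYosida_ne_bot_and_mem_resolventSet {φ : X → EReal} (hbot : ∀ x, φ x ≠ ⊥) {τ : ℝ}
    {x w : X} (hw : w ∈ dom φ)
    (hmin : IsMinOn (fun z => energy φ z + dist x z ^ 2 / (2 * τ)) (dom φ) w) :
    moreauYosida φ τ x ≠ ⊥ ∧ w ∈ resolventSet φ τ x := by
  have heq : φ w + ((dist x w ^ 2 / (2 * τ) : ℝ) : EReal) = moreauYosida φ τ x := by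
    refine le_antisymm (le_iInf fun z => ?_) (moreauYosida_le φ τ x w)
    by_cases hz : z ∈ dom φ
    · rw [← coe_energy hbot hw, ← coe_energy hbot hz]
      exact_mod_cast hmin hz
    · rw [not_not.1 hz, EReal.top_add_coe]
      exact le_top
  refine ⟨?_, heq⟩
  rw [← heq, ← coe_energy hbot hw, ← EReal.coe_add]
  exact EReal.coe_ne_bot _

lemma sq_le_of_cos_add_cos_le {R a b c D : ℝ} (hR : R < Real.pi / 2) (hD : D ∈ Icc 0 R)
    (ha : a ∈ Icc 0 R) (hb : b ∈ Icc 0 R) (hc : c ∈ Icc 0 R)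
    (h : Real.cos a + Real.cos c ≤ 2 * Real.cos (b / 2) * Real.cos D) :
    D ^ 2 ≤ (a ^ 2 + c ^ 2) / 2 - Real.cos R / Real.pi ^ 2 * b ^ 2 := by
  have hpi := Real.pi_pos
  have hcosb : b ^ 2 / Real.pi ^ 2 ≤ 2 * (1 - Real.cos (b / 2)) := by
    have hquad : Real.cos (b / 2) ≤ 1 - 2 / Real.pi ^ 2 * (b / 2) ^ 2 :=
      Real.cos_le_one_sub_mul_cos_sq (by rw [abs_of_nonneg] <;> linarith [hb.1, hb.2])
    rw [show 2 / Real.pi ^ 2 * (b / 2) ^ 2 = b ^ 2 / Real.pi ^ 2 / 2 by ring] at hquad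
    linarith
  rw [show Real.cos R / Real.pi ^ 2 * b ^ 2 = Real.cos R * (b ^ 2 / Real.pi ^ 2) by ring]
  rcases hD.1.eq_or_lt with rfl | hD0
  · have hcosR : Real.cos R * (b ^ 2 / Real.pi ^ 2) ≤ 1 * (b ^ 2 / Real.pi ^ 2) :=
      mul_le_mul_of_nonneg_right (Real.cos_le_one R) (by positivity)
    rw [Real.cos_zero] at h
    linarith [Real.one_sub_sq_div_two_le_cos (x := a), Real.one_sub_sq_div_two_le_cos (x := c)]
  · have hmem {u : ℝ} (hu : u ∈ Icc 0 R) : u ∈ Icc 0 Real.pi := ⟨hu.1, by linarith [hu.2]⟩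
    have hsin : 0 < Real.sin D := Real.sin_pos_of_pos_of_lt_pi hD0 (by linarith [hD.2])
    have hcosR : 0 ≤ Real.cos R := Real.cos_nonneg_of_mem_Icc ⟨by linarith [hD.2], hR.le⟩
    have hcosD : Real.cos R ≤ Real.cos D :=
      Real.cos_le_cos_of_nonneg_of_le_pi hD.1 (by linarith) hD.2
    set W := Real.cos R * (b ^ 2 / Real.pi ^ 2)
    have hW0 : 0 ≤ W := by positivity
    have hW : W ≤ 2 * Real.cos D * (1 - Real.cos (b / 2)) :=
      calc W ≤ Real.cos D * (2 * (1 - Real.cos (b / 2))) :=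
          mul_le_mul hcosD hcosb (by positivity) (hcosR.trans hcosD)
        _ = 2 * Real.cos D * (1 - Real.cos (b / 2)) := by ring
    -- Sum of the two tangent line inequalities at `cos D`.
    have htangent : 2 * D * W ≤ Real.sin D * (a ^ 2 + c ^ 2 - 2 * D ^ 2) :=
      calc 2 * D * W ≤ 2 * D * (2 * Real.cos D - (Real.cos a + Real.cos c)) :=
          mul_le_mul_of_nonneg_left (by linarith) (by linarith)
        _ ≤ Real.sin D * (a ^ 2 + c ^ 2 - 2 * D ^ 2) := by
          linarith [two_mul_mul_cos_sub_cos_le (hmem hD) (hmem ha),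
            two_mul_mul_cos_sub_cos_le (hmem hD) (hmem hc)]
    have hnonneg : 0 ≤ a ^ 2 + c ^ 2 - 2 * D ^ 2 :=
      nonneg_of_mul_nonneg_right ((mul_nonneg (by linarith) hW0).trans htangent) hsin
    have hdiv : 2 * W ≤ a ^ 2 + c ^ 2 - 2 * D ^ 2 := by
      refine le_of_mul_le_mul_left ?_ hD0
      linarith [mul_le_mul_of_nonneg_right (Real.sin_le hD.1) hnonneg]
    linarith

lemma IsCAT1.cos_add_cos_le (hX : IsCAT1 X) {x y z : X} {γ : ℝ → X}
    (hper : dist x y + dist y z + dist z x < 2 * Real.pi) (hγ : IsMinGeodesic γ y z) :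
    Real.cos (dist x y) + Real.cos (dist x z) ≤
      2 * Real.cos (dist y z / 2) * Real.cos (dist x (γ (1 / 2))) := by
  have hmem : (1 / 2 : ℝ) ∈ Icc (0 : ℝ) 1 := ⟨by norm_num, by norm_num⟩
  rcases eq_or_ne y z with rfl | hne
  · have hmid : dist y (γ (1 / 2)) = 1 / 2 * dist y y := hγ.left_apply hmem
    rw [dist_self, mul_zero, dist_eq_zero] at hmid
    rw [← hmid, dist_self, zero_div, Real.cos_zero]
    linarith
  · have hhalf : 0 < Real.sin (dist y z / 2) :=
      Real.sin_pos_of_pos_of_lt_pi (half_pos (dist_pos.2 hne))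
        (by linarith [dist_triangle y x z, dist_comm y x, dist_comm x z, Real.pi_pos])
    have hcomp := hX.sin_mul_cos_dist_ge hper hγ hmem
    rw [show (1 - 1 / 2 : ℝ) * dist y z = dist y z / 2 by ring,
      show 1 / 2 * dist y z = dist y z / 2 by ring,
      show dist y z = 2 * (dist y z / 2) by ring, Real.sin_two_mul,
      show 2 * (dist y z / 2) / 2 = dist y z / 2 by ring] at hcomp
    refine le_of_mul_le_mul_left ?_ hhalf
    linarith

lemma IsCAT1.sq_dist_midpoint_le (hX : IsCAT1 X) {R : ℝ} (hR : R < Real.pi / 2)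
    (hd : ∀ x y : X, dist x y ≤ R) {x y z : X} {γ : ℝ → X} (hγ : IsMinGeodesic γ y z) :
    dist x (γ (1 / 2)) ^ 2 ≤ (dist x y ^ 2 + dist x z ^ 2) / 2
      - Real.cos R / Real.pi ^ 2 * dist y z ^ 2 :=
  sq_le_of_cos_add_cos_le hR ⟨dist_nonneg, hd _ _⟩ ⟨dist_nonneg, hd _ _⟩ ⟨dist_nonneg, hd _ _⟩
    ⟨dist_nonneg, hd _ _⟩
    (hX.cos_add_cos_le (by linarith [hd x y, hd y z, hd z x, Real.pi_pos]) hγ)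

lemma IsLamConvex.exists_energy_ge {φ : X → EReal} (hbot : ∀ x, φ x ≠ ⊥)
    (hdom : (dom φ).Nonempty) (hlsc : LowerSemicontinuous φ) {lam : ℝ} (hφ : IsLamConvex φ lam)
    {R : ℝ} (hd : ∀ x y : X, dist x y ≤ R) : ∃ B : ℝ, ∀ y ∈ dom φ, B ≤ energy φ y := by
  obtain ⟨o, ho⟩ := hdom
  have hR0 : 0 ≤ R := dist_nonneg.trans (hd o o)
  have hlt : ((energy φ o - 1 : ℝ) : EReal) < φ o := by
    rw [← coe_energy hbot ho]
    exact_mod_cast sub_one_lt (energy φ o)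
  obtain ⟨ρ, hρ, hball⟩ := Metric.eventually_nhds_iff.1 (hlsc o _ hlt)
  obtain ⟨t, ht0, ht1, htR⟩ : ∃ t : ℝ, 0 < t ∧ t ≤ 1 ∧ t * R < ρ := by
    refine ⟨ρ / (ρ + R), by positivity, (div_le_one (by positivity)).2 (by linarith), ?_⟩
    rw [div_mul_eq_mul_div, div_lt_iff₀ (by positivity)]
    linarith [mul_pos hρ hρ]
  refine ⟨energy φ o - 1 / t - |lam| / 2 * R ^ 2, fun y hy => ?_⟩
  obtain ⟨γ, hγ, hconv⟩ := hφ o ho y hy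
  have hmem : t ∈ Icc (0 : ℝ) 1 := ⟨ht0.le, ht1⟩
  have hdist : dist o (γ t) = t * dist o y := hγ.left_apply hmem
  have hnear : dist (γ t) o < ρ := by
    rw [dist_comm, hdist]
    exact (mul_le_mul_of_nonneg_left (hd o y) ht0.le).trans_lt htR
  obtain ⟨hγt, hle⟩ :=
    hconv.mem_dom_and_energy_le hbot (hγ.1.symm ▸ ho) (hγ.2.1.symm ▸ hy) hmem
  have hge : energy φ o - 1 < energy φ (γ t) := by
    have : ((energy φ o - 1 : ℝ) : EReal) < φ (γ t) := hball hnear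
    rw [← coe_energy hbot hγt] at this
    exact_mod_cast this
  have hquad : -lam * ((1 - t) * dist o y ^ 2) ≤ |lam| * (1 * R ^ 2) :=
    mul_le_mul (neg_le_abs lam) (mul_le_mul (by linarith) (pow_le_pow_left₀ dist_nonneg (hd o y) 2)
      (sq_nonneg _) zero_le_one) (mul_nonneg (by linarith) (sq_nonneg _)) (abs_nonneg lam)
  rw [hγ.1, hγ.2.1] at hle
  refine le_of_mul_le_mul_left ?_ ht0
  rw [mul_sub, mul_sub, mul_one_div_cancel ht0.ne']
  linarith [mul_le_mul_of_nonneg_left hquad (half_pos ht0).le]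

lemma IsCAT1.exists_energy_add_sq_dist_le (hX : IsCAT1 X) {φ : X → EReal} (hbot : ∀ x, φ x ≠ ⊥)
    {lam : ℝ} (hφ : IsLamConvex φ lam) {R : ℝ} (hR : R < Real.pi / 2)
    (hd : ∀ x y : X, dist x y ≤ R) {τ : ℝ} (hτ : 0 < τ) (x : X) {y z : X} (hy : y ∈ dom φ)
    (hz : z ∈ dom φ) :
    ∃ w ∈ dom φ, energy φ w + dist x w ^ 2 / (2 * τ)
        + (lam / 8 + Real.cos R / Real.pi ^ 2 / (2 * τ)) * dist y z ^ 2 ≤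
      ((energy φ y + dist x y ^ 2 / (2 * τ)) + (energy φ z + dist x z ^ 2 / (2 * τ))) / 2 := by
  obtain ⟨γ, hγ, hconv⟩ := hφ y hy z hz
  obtain ⟨hmid, hle⟩ := hconv.mem_dom_and_energy_le hbot (hγ.1.symm ▸ hy) (hγ.2.1.symm ▸ hz)
    (t := 1 / 2) ⟨by norm_num, by norm_num⟩
  rw [hγ.1, hγ.2.1] at hle
  have hsq := div_le_div_of_nonneg_right (hX.sq_dist_midpoint_le hR hd (x := x) hγ)
    (by positivity : 0 ≤ 2 * τ)
  refine ⟨γ (1 / 2), hmid, ?_⟩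
  rw [sub_div, div_div, mul_div_right_comm] at hsq
  linarith [add_div (dist x y ^ 2) (dist x z ^ 2) (2 * (2 * τ)),
    (by ring : (dist x y ^ 2 + dist x z ^ 2) / (2 * (2 * τ)) =
      (dist x y ^ 2 / (2 * τ) + dist x z ^ 2 / (2 * τ)) / 2)]

lemma IsCAT1.isCoercive [CompleteSpace X] (hX : IsCAT1 X) {φ : X → EReal} (hbot : ∀ x, φ x ≠ ⊥)
    (hdom : (dom φ).Nonempty) (hlsc : LowerSemicontinuous φ) {lam : ℝ} (hφ : IsLamConvex φ lam)
    (hdiam : Metric.ediam (univ : Set X) < ENNReal.ofReal (Real.pi / 2)) : IsCoercive φ := by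
  have hfin : Metric.ediam (univ : Set X) ≠ ⊤ := (hdiam.trans ENNReal.ofReal_lt_top).ne
  have hR : Metric.diam (univ : Set X) < Real.pi / 2 :=
    (ENNReal.lt_ofReal_iff_toReal_lt hfin).1 hdiam
  have hd (x y : X) : dist x y ≤ Metric.diam (univ : Set X) :=
    Metric.dist_le_diam_of_mem (Metric.isBounded_iff_ediam_ne_top.2 hfin) (mem_univ x) (mem_univ y)
  obtain ⟨B, hB⟩ := hφ.exists_energy_ge hbot hdom hlsc hd
  have hcos : 0 < Real.cos (Metric.diam (univ : Set X)) :=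
    Real.cos_pos_of_mem_Ioo
      ⟨by linarith [Real.pi_pos, Metric.diam_nonneg (s := (univ : Set X))], hR⟩
  set k := Real.cos (Metric.diam (univ : Set X)) / Real.pi ^ 2
  have hk : 0 < k := by positivity
  refine ⟨4 * k / (|lam| + 1), div_pos (mul_pos four_pos hk) (by positivity), fun τ hτ hτs x => ?_⟩
  have hc : 0 < lam / 8 + k / (2 * τ) := by
    have : (|lam| + 1) / 8 < k / (2 * τ) := by
      rw [lt_div_iff₀ (by positivity)] at hτs ⊢
      linarith
    linarith [neg_abs_le lam]
  have hcont : Continuous fun w : X => dist x w ^ 2 / (2 * τ) := by fun_prop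
  have hbdd : BddBelow ((fun w => energy φ w + dist x w ^ 2 / (2 * τ)) '' dom φ) := by
    refine ⟨B, forall_mem_image.2 fun w hw => ?_⟩
    have : 0 ≤ dist x w ^ 2 / (2 * τ) := by positivity
    linarith [hB w hw]
  obtain ⟨v, hv, hmin⟩ := exists_isMinOn_of_midpoint_convex hdom hc hbdd
    (isClosed_setOf_energy_add_le hbot hlsc hcont)
    fun y hy z hz => hX.exists_energy_add_sq_dist_le hbot hφ hR hd hτ x hy hz
  exact (moreauYosida_ne_bot_and_mem_resolventSet hbot hv hmin).imp_right fun hmem => ⟨v, hmem⟩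

end Coercivity

/-! ### A priori bounds along discrete solutions -/

section DiscreteSolutions

lemma le_exp_mul_of_le_add_mul {a b u : ℝ} (hu : 0 ≤ u) (hu2 : u ≤ 1 / 2) (ha : 0 ≤ a)
    (h : a ≤ b + u * a) : a ≤ Real.exp (2 * u) * b := by
  have hinv : 1 ≤ (1 + 2 * u) * (1 - u) := by nlinarith
  have hexp : 1 + 2 * u ≤ Real.exp (2 * u) := by linarith [Real.add_one_le_exp (2 * u)]
  have hab : (1 - u) * a ≤ b := by linarith
  have hb : 0 ≤ b := (mul_nonneg (by linarith) ha).trans hab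
  calc a ≤ (1 + 2 * u) * (1 - u) * a := le_mul_of_one_le_left ha hinv
    _ = (1 + 2 * u) * ((1 - u) * a) := mul_assoc _ _ _
    _ ≤ (1 + 2 * u) * b := by gcongr
    _ ≤ Real.exp (2 * u) * b := by gcongr

namespace TimePartition

lemma step_pos (P : TimePartition) (k : ℕ) : 0 < P.t (k + 1) - P.t k :=
  sub_pos.2 (P.strictMono k.lt_succ_self)

lemma t_nonneg (P : TimePartition) (k : ℕ) : 0 ≤ P.t k :=
  P.t_zero.symm.trans_le (P.strictMono.monotone k.zero_le)

lemma step_lt_of_mesh_lt {P : TimePartition} {δ : ℝ} (h : P.mesh < ENNReal.ofReal δ) (k : ℕ) :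
    P.t (k + 1) - P.t k < δ :=
  (ENNReal.ofReal_lt_ofReal_iff_of_nonneg (P.step_pos k).le).1
    ((le_iSup (fun k => ENNReal.ofReal (P.t (k + 1) - P.t k)) k).trans_lt h)

/-- The index of the node that carries the value of interpolations at time `s`. -/
def index (P : TimePartition) (s : ℝ≥0) : ℕ := sInf {k : ℕ | (s : ℝ) ≤ P.t k}

lemma le_t_index (P : TimePartition) (s : ℝ≥0) : (s : ℝ) ≤ P.t (P.index s) :=
  Nat.sInf_mem (s := {k : ℕ | (s : ℝ) ≤ P.t k}) (P.tendsto.eventually_ge_atTop (s : ℝ)).exists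

lemma index_le_iff {P : TimePartition} {s : ℝ≥0} {k : ℕ} : P.index s ≤ k ↔ (s : ℝ) ≤ P.t k :=
  ⟨fun h => (P.le_t_index s).trans (P.strictMono.monotone h), fun h => Nat.sInf_le h⟩

lemma lt_index_iff {P : TimePartition} {s : ℝ≥0} {k : ℕ} : k < P.index s ↔ P.t k < s := by
  rw [← not_le, index_le_iff, not_le]

lemma index_mono (P : TimePartition) : Monotone P.index :=
  fun _ s h => index_le_iff.2 ((NNReal.coe_le_coe.2 h).trans (P.le_t_index s))

lemma index_zero (P : TimePartition) : P.index 0 = 0 :=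
  Nat.le_zero.1 (index_le_iff.2 P.t_zero.ge)

lemma t_index_lt {P : TimePartition} {δ : ℝ} (hP : P.mesh < ENNReal.ofReal δ) (s : ℝ≥0) :
    P.t (P.index s) < s + δ := by
  rcases hk : P.index s with _ | k
  · linarith [P.t_zero, s.coe_nonneg, P.step_pos 0, step_lt_of_mesh_lt hP 0]
  · linarith [step_lt_of_mesh_lt hP k, lt_index_iff.1 (k.lt_succ_self.trans_eq hk.symm)]

lemma le_exp_mul_of_succ_le_add_mul (P : TimePartition) {c : ℝ} (hc : 0 ≤ c)
    (hstep : ∀ k, c * (P.t (k + 1) - P.t k) ≤ 1 / 2) {Y : ℕ → ℝ} (hY : ∀ k, 0 ≤ Y k)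
    (h : ∀ k, Y (k + 1) ≤ Y k + c * (P.t (k + 1) - P.t k) * Y (k + 1)) (n : ℕ) :
    Y n ≤ Real.exp (2 * c * P.t n) * Y 0 := by
  induction n with
  | zero => simp [P.t_zero]
  | succ n ih =>
    calc Y (n + 1) ≤ Real.exp (2 * (c * (P.t (n + 1) - P.t n))) * Y n :=
          le_exp_mul_of_le_add_mul (mul_nonneg hc (P.step_pos n).le) (hstep n) (hY _) (h n)
      _ ≤ Real.exp (2 * (c * (P.t (n + 1) - P.t n))) * (Real.exp (2 * c * P.t n) * Y 0) := by
          gcongr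
      _ = Real.exp (2 * c * P.t (n + 1)) * Y 0 := by
          rw [← mul_assoc, ← Real.exp_add]
          ring_nf

end TimePartition

lemma add_sq_le_of_sq_le {u v a b α β : ℝ} (ha : 0 ≤ a) (hα : 0 ≤ α) (hb : 0 ≤ b) (hβ : 0 ≤ β)
    (hu : u ^ 2 ≤ 2 * a * α) (hv : v ^ 2 ≤ 2 * b * β) :
    (u + v) ^ 2 ≤ 2 * (a + b) * (α + β) := by
  have hsq : (u * v) ^ 2 ≤ (a * β + b * α) ^ 2 := by
    calc (u * v) ^ 2 = u ^ 2 * v ^ 2 := mul_pow _ _ _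
      _ ≤ (2 * a * α) * (2 * b * β) := by gcongr
      _ ≤ (a * β + b * α) ^ 2 := by linarith [sq_nonneg (a * β - b * α)]
  linarith [(abs_le_of_sq_le_sq' hsq (by positivity)).2]

variable {X : Type*} [MetricSpace X]

lemma sq_dist_le_add_mul_sq_dist (o x y : X) {s : ℝ} (hs : 0 < s) :
    dist o y ^ 2 ≤ dist o x ^ 2 + s * dist x y ^ 2 + 1 / s * dist o y ^ 2 := by
  have htri : dist o y ≤ dist o x + dist x y := dist_triangle o x y
  have hyoung : 2 * (dist x y * dist o y) ≤ s * dist x y ^ 2 + 1 / s * dist o y ^ 2 := by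
    have hsq : 0 ≤ s * (dist x y - 1 / s * dist o y) ^ 2 := by positivity
    have : s * (1 / s) = 1 := mul_one_div_cancel hs.ne'
    linear_combination hsq - (2 * dist x y * dist o y - 1 / s * dist o y ^ 2) * this
  linarith [mul_le_mul_of_nonneg_left htri (dist_nonneg (x := o) (y := y)),
    sq_nonneg (dist o y - dist o x)]

variable {φ : X → EReal} {P : TimePartition} {x₀ : X} {x : ℕ → X}

namespace IsDiscreteSolution

lemma mem_dom (h : IsDiscreteSolution φ P x₀ x) (hx₀ : x₀ ∈ dom φ) (k : ℕ) : x k ∈ dom φ := by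
  induction k with
  | zero => rwa [h.1]
  | succ k ih => exact mem_dom_of_mem_resolventSet ih (h.2 k)

lemma sq_dist_succ_le (h : IsDiscreteSolution φ P x₀ x) (hbot : ∀ x, φ x ≠ ⊥) (hx₀ : x₀ ∈ dom φ)
    (k : ℕ) : dist (x k) (x (k + 1)) ^ 2 ≤
      2 * (P.t (k + 1) - P.t k) * (energy φ (x k) - energy φ (x (k + 1))) := by
  have hk := h.mem_dom hx₀ k
  have hmin := energy_add_le_of_mem_resolventSet hbot (h.2 k) hk hk
  rw [dist_self, zero_pow two_ne_zero, zero_div, ← le_sub_iff_add_le',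
    div_le_iff₀ (mul_pos two_pos (P.step_pos k))] at hmin
  linarith

lemma energy_antitone (h : IsDiscreteSolution φ P x₀ x) (hbot : ∀ x, φ x ≠ ⊥)
    (hx₀ : x₀ ∈ dom φ) : Antitone fun k => energy φ (x k) :=
  antitone_nat_of_succ_le fun k => sub_nonneg.1 <| nonneg_of_mul_nonneg_right
    ((sq_nonneg _).trans (h.sq_dist_succ_le hbot hx₀ k)) (mul_pos two_pos (P.step_pos k))

lemma energy_le (h : IsDiscreteSolution φ P x₀ x) (hbot : ∀ x, φ x ≠ ⊥) (hx₀ : x₀ ∈ dom φ)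
    (k : ℕ) : energy φ (x k) ≤ energy φ x₀ := by
  simpa only [h.1] using h.energy_antitone hbot hx₀ k.zero_le

lemma sq_dist_le (h : IsDiscreteSolution φ P x₀ x) (hbot : ∀ x, φ x ≠ ⊥) (hx₀ : x₀ ∈ dom φ)
    {i k : ℕ} (hik : i ≤ k) :
    dist (x i) (x k) ^ 2 ≤ 2 * (P.t k - P.t i) * (energy φ (x i) - energy φ (x k)) := by
  have hanti := h.energy_antitone hbot hx₀
  induction k, hik using Nat.le_induction with
  | base => simp
  | succ k hik ih =>
    calc dist (x i) (x (k + 1)) ^ 2 ≤ (dist (x i) (x k) + dist (x k) (x (k + 1))) ^ 2 := by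
          gcongr; exact dist_triangle _ _ _
      _ ≤ 2 * ((P.t k - P.t i) + (P.t (k + 1) - P.t k)) *
            ((energy φ (x i) - energy φ (x k)) + (energy φ (x k) - energy φ (x (k + 1)))) :=
          add_sq_le_of_sq_le (sub_nonneg.2 (P.strictMono.monotone hik))
            (sub_nonneg.2 (hanti hik)) (P.step_pos k).le (sub_nonneg.2 (hanti k.le_succ)) ih
            (h.sq_dist_succ_le hbot hx₀ k)
      _ = 2 * (P.t (k + 1) - P.t i) * (energy φ (x i) - energy φ (x (k + 1))) := by ring

end IsDiscreteSolution

/-- The squared distance from `o` plus the multiple `τ` of the energy raised by `A`: the Lyapunov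
type quantity that yields lower energy bounds along discrete solutions. -/
def augmentedEnergy (φ : X → EReal) (o : X) (A τ : ℝ) (z : X) : ℝ :=
  dist o z ^ 2 + τ * (energy φ z + A)

lemma half_sq_dist_le_augmentedEnergy {o z : X} {A τ : ℝ} (hτ : 0 < τ)
    (hz : -A ≤ energy φ z + dist o z ^ 2 / (2 * τ)) :
    dist o z ^ 2 / 2 ≤ augmentedEnergy φ o A τ z := by
  have hmul := mul_le_mul_of_nonneg_left hz hτ.le
  have hcancel : τ * (dist o z ^ 2 / (2 * τ)) = dist o z ^ 2 / 2 := by field_simp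
  rw [augmentedEnergy]
  linarith

lemma IsDiscreteSolution.augmentedEnergy_succ_le (h : IsDiscreteSolution φ P x₀ x)
    (hbot : ∀ x, φ x ≠ ⊥) (hx₀ : x₀ ∈ dom φ) {o : X} {A τ : ℝ} (hτ : 0 < τ)
    (hlow : ∀ z ∈ dom φ, -A ≤ energy φ z + dist o z ^ 2 / (2 * τ)) (k : ℕ) :
    augmentedEnergy φ o A τ (x (k + 1)) ≤ augmentedEnergy φ o A τ (x k)
      + 4 / τ * (P.t (k + 1) - P.t k) * augmentedEnergy φ o A τ (x (k + 1)) := by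
  have hstep := P.step_pos k
  have hbound : 4 / τ * (P.t (k + 1) - P.t k) * (dist o (x (k + 1)) ^ 2 / 2) ≤
      4 / τ * (P.t (k + 1) - P.t k) * augmentedEnergy φ o A τ (x (k + 1)) := by
    gcongr
    exact half_sq_dist_le_augmentedEnergy hτ (hlow _ (h.mem_dom hx₀ _))
  have hdist := h.sq_dist_succ_le hbot hx₀ k
  have hsq := sq_dist_le_add_mul_sq_dist o (x k) (x (k + 1))
    (s := τ / (2 * (P.t (k + 1) - P.t k))) (by positivity)
  generalize P.t (k + 1) - P.t k = σ at *
  have hslope : τ / (2 * σ) * dist (x k) (x (k + 1)) ^ 2 ≤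
      τ * (energy φ (x k) - energy φ (x (k + 1))) := by
    rw [div_mul_eq_mul_div, div_le_iff₀ (by positivity)]
    linarith [mul_le_mul_of_nonneg_left hdist hτ.le]
  have hcoeff : 1 / (τ / (2 * σ)) * dist o (x (k + 1)) ^ 2 =
      4 / τ * σ * (dist o (x (k + 1)) ^ 2 / 2) := by
    field_simp
    ring
  rw [hcoeff] at hsq
  simp only [augmentedEnergy] at hbound ⊢
  linarith

lemma IsDiscreteSolution.energy_ge (h : IsDiscreteSolution φ P x₀ x) (hbot : ∀ x, φ x ≠ ⊥)
    (hx₀ : x₀ ∈ dom φ) {o : X} {A τ T C R : ℝ} (hτ : 0 < τ)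
    (hlow : ∀ z ∈ dom φ, -A ≤ energy φ z + dist o z ^ 2 / (2 * τ))
    (hP : P.mesh < ENNReal.ofReal (τ / 8)) (hC : energy φ x₀ ≤ C) (hR : dist o x₀ ≤ R) {n : ℕ}
    (hn : P.t n ≤ T) :
    -(A + Real.exp (8 / τ * T) * (R ^ 2 + τ * (C + A)) / τ) ≤ energy φ (x n) := by
  have hhalf (k : ℕ) : dist o (x k) ^ 2 / 2 ≤ augmentedEnergy φ o A τ (x k) :=
    half_sq_dist_le_augmentedEnergy hτ (hlow _ (h.mem_dom hx₀ k))
  have hnonneg (k : ℕ) : 0 ≤ augmentedEnergy φ o A τ (x k) := le_trans (by positivity) (hhalf k)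
  have hstep (k : ℕ) : 4 / τ * (P.t (k + 1) - P.t k) ≤ 1 / 2 := by
    rw [div_mul_eq_mul_div, div_le_iff₀ hτ]
    linarith [TimePartition.step_lt_of_mesh_lt hP k]
  have hinit : augmentedEnergy φ o A τ (x 0) ≤ R ^ 2 + τ * (C + A) := by
    rw [augmentedEnergy, h.1]
    gcongr
  have hgronwall : augmentedEnergy φ o A τ (x n) ≤
      Real.exp (8 / τ * T) * (R ^ 2 + τ * (C + A)) := by
    refine (P.le_exp_mul_of_succ_le_add_mul (by positivity) hstep hnonneg
      (h.augmentedEnergy_succ_le hbot hx₀ hτ hlow) n).trans ?_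
    have hcoeff : 2 * (4 / τ) = 8 / τ := by ring
    rw [hcoeff]
    gcongr
    exact hnonneg 0
  have hquot := div_le_div_of_nonneg_right ((hhalf n).trans hgronwall) hτ.le
  rw [div_div] at hquot
  linarith [hlow _ (h.mem_dom hx₀ n)]

lemma IsCoercive.exists_quadratic_bound (h : IsCoercive φ) (hbot : ∀ x, φ x ≠ ⊥) {o : X}
    (ho : o ∈ dom φ) : ∃ A τ : ℝ, 0 < τ ∧
      ∀ z ∈ dom φ, -A ≤ energy φ z + dist o z ^ 2 / (2 * τ) := by
  obtain ⟨τs, hτs, h⟩ := h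
  obtain ⟨-, v, hv⟩ := h (τs / 2) (half_pos hτs) (half_lt_self hτs) o
  refine ⟨-(energy φ v + dist o v ^ 2 / (2 * (τs / 2))), τs / 2, half_pos hτs, fun z hz => ?_⟩
  rw [neg_neg]
  exact energy_add_le_of_mem_resolventSet hbot hv ho hz

lemma IsCoercive.exists_energy_ge (h : IsCoercive φ) (hbot : ∀ x, φ x ≠ ⊥) {o : X}
    (ho : o ∈ dom φ) (C R T : ℝ) :
    ∃ m δ : ℝ, 0 < δ ∧ ∀ (P : TimePartition) (x₀ : X) (x : ℕ → X), P.mesh < ENNReal.ofReal δ →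
      IsDiscreteSolution φ P x₀ x → x₀ ∈ dom φ → energy φ x₀ ≤ C → dist o x₀ ≤ R →
      ∀ n, P.t n ≤ T → -m ≤ energy φ (x n) := by
  obtain ⟨A, τ, hτ, hlow⟩ := h.exists_quadratic_bound hbot ho
  exact ⟨_, τ / 8, by positivity, fun P x₀ x hP hx hx₀ hC hR n =>
    hx.energy_ge hbot hx₀ hτ hlow hP hC hR⟩

lemma IsCoercive.exists_isDiscreteSolution (h : IsCoercive φ) :
    ∃ δ : ℝ, 0 < δ ∧ ∀ P : TimePartition, P.mesh < ENNReal.ofReal δ → ∀ x₀ : X,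
      ∃ x : ℕ → X, IsDiscreteSolution φ P x₀ x := by
  obtain ⟨τs, hτs, h⟩ := h
  refine ⟨τs, hτs, fun P hP x₀ => ?_⟩
  choose f hf using fun (k : ℕ) (z : X) =>
    (h _ (P.step_pos k) (TimePartition.step_lt_of_mesh_lt hP k) z).2
  exact ⟨fun n => Nat.rec x₀ f n, rfl, fun k => hf k _⟩

end DiscreteSolutions

/-! ### Comparison of two discrete solutions -/

section Stability

/-- The time intervals that end at the `i`-th node of `P` and at the `j`-th node of `Q` touch. -/
def Linked (P Q : TimePartition) (i j : ℕ) : Prop :=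
  (∀ k < i, P.t k ≤ Q.t j) ∧ ∀ k < j, Q.t k ≤ P.t i

lemma linked_index (P Q : TimePartition) (s : ℝ≥0) : Linked P Q (P.index s) (Q.index s) :=
  ⟨fun _ hk => (TimePartition.lt_index_iff.1 hk).le.trans (Q.le_t_index s),
    fun _ hk => (TimePartition.lt_index_iff.1 hk).le.trans (P.le_t_index s)⟩

lemma linked_zero (P Q : TimePartition) : Linked P Q 0 0 :=
  ⟨by simp, by simp⟩

lemma Linked.symm {P Q : TimePartition} {i j : ℕ} (h : Linked P Q i j) : Linked Q P j i :=
  ⟨h.2, h.1⟩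

lemma Linked.sub_le {P Q : TimePartition} {i j : ℕ} (h : Linked P Q i j) {δ : ℝ}
    (hP : ∀ k, P.t (k + 1) - P.t k ≤ δ) : P.t i - Q.t j ≤ δ := by
  rcases i with _ | k
  · linarith [P.t_zero, Q.t_nonneg j, P.step_pos 0, hP 0]
  · linarith [h.1 k k.lt_succ_self, hP k]

/-- Two partitions can be traversed together, advancing one of them by one node at a time. -/
@[elab_as_elim]
lemma Linked.induction {P Q : TimePartition} {motive : ∀ i j, Linked P Q i j → Prop}
    (zero : motive 0 0 (linked_zero P Q))
    (left : ∀ i j h h', motive i j h → motive (i + 1) j h')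
    (right : ∀ i j h h', motive i j h → motive i (j + 1) h')
    (i j : ℕ) (h : Linked P Q i j) : motive i j h := by
  match i, j with
  | 0, 0 => exact zero
  | 0, j + 1 =>
    have hj : Linked P Q 0 j := ⟨by simp, fun k hk => h.2 k (hk.trans j.lt_succ_self)⟩
    exact right 0 j hj h (induction zero left right 0 j hj)
  | i + 1, 0 =>
    have hi : Linked P Q i 0 := ⟨fun k hk => h.1 k (hk.trans i.lt_succ_self), by simp⟩
    exact left i 0 hi h (induction zero left right i 0 hi)
  | i + 1, j + 1 =>
    rcases le_total (Q.t j) (P.t i) with hle | hle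
    · have hi : Linked P Q i (j + 1) := ⟨fun k hk => h.1 k (hk.trans i.lt_succ_self),
        fun k hk => (Q.strictMono.monotone (Nat.le_of_lt_succ hk)).trans hle⟩
      exact left i (j + 1) hi h (induction zero left right i (j + 1) hi)
    · have hj : Linked P Q (i + 1) j :=
        ⟨fun k hk => (P.strictMono.monotone (Nat.le_of_lt_succ hk)).trans hle,
          fun k hk => h.2 k (hk.trans j.lt_succ_self)⟩
      exact right (i + 1) j hj h (induction zero left right (i + 1) j hj)

variable {X : Type*} [MetricSpace X] {φ : X → EReal} {P Q : TimePartition} {x y : ℕ → X}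

/-- The squared distance of two discrete solutions at the nodes `i` and `j`, corrected by their
energies so that its growth along linked nodes is controlled by `LocalEVI`; `-m` is meant to be a
lower bound of the energies and `c` a multiple of the step size. -/
def gap (φ : X → EReal) (P Q : TimePartition) (x y : ℕ → X) (c m : ℝ) (i j : ℕ) : ℝ :=
  dist (x i) (y j) ^ 2 + 2 * (P.t i - Q.t j) * (energy φ (x i) - energy φ (y j))
    + c * (energy φ (x i) + energy φ (y j) + 2 * m)

lemma gap_comm (φ : X → EReal) (P Q : TimePartition) (x y : ℕ → X) (c m : ℝ) (i j : ℕ) :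
    gap φ P Q x y c m i j = gap φ Q P y x c m j i := by
  rw [gap, gap, dist_comm (x i) (y j)]
  ring

lemma sq_dist_le_gap {i j : ℕ} {δ c m : ℝ} (hδ : |P.t i - Q.t j| ≤ δ) (hc : 2 * δ ≤ c)
    (hx : -m ≤ energy φ (x i)) (hy : -m ≤ energy φ (y j)) :
    dist (x i) (y j) ^ 2 ≤ gap φ P Q x y c m i j := by
  have henergy : |energy φ (x i) - energy φ (y j)| ≤ energy φ (x i) + energy φ (y j) + 2 * m :=
    abs_le.2 ⟨by linarith, by linarith⟩
  have hmul := mul_le_mul hδ henergy (abs_nonneg _) ((abs_nonneg _).trans hδ)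
  rw [← abs_mul] at hmul
  have hcmul := mul_le_mul_of_nonneg_right hc ((abs_nonneg _).trans henergy)
  rw [gap]
  linarith [(abs_le.1 hmul).1]

lemma gap_zero_le {C δ κ m : ℝ} (hκ : 0 ≤ κ) (hδ : δ ≤ 1) (hxy : dist (x 0) (y 0) ≤ δ)
    (hx : energy φ (x 0) ≤ C) (hy : energy φ (y 0) ≤ C) :
    gap φ P Q x y (2 * (1 + κ) * δ) m 0 0 ≤ (1 + 4 * (1 + κ) * (C + m)) * δ := by
  have hδ0 : 0 ≤ δ := dist_nonneg.trans hxy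
  have henergy : energy φ (x 0) + energy φ (y 0) + 2 * m ≤ 2 * (C + m) := by linarith
  have hdist : dist (x 0) (y 0) ^ 2 ≤ δ :=
    (pow_le_of_le_one dist_nonneg (hxy.trans hδ) two_ne_zero).trans hxy
  rw [gap, P.t_zero, Q.t_zero]
  linarith [mul_le_mul_of_nonneg_left henergy (by positivity : 0 ≤ 2 * (1 + κ) * δ)]

/-- A discrete solution with steps of size at most `δ`, starting in the domain, whose energy up to
time `T` is at least `-m` and whose jumps up to time `T` are smaller than the radius `r` of
`LocalEVI`. -/
structure IsFineSolution (φ : X → EReal) (P : TimePartition) (x : ℕ → X) (δ m T r : ℝ) :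
    Prop where
  isDiscreteSolution : IsDiscreteSolution φ P (x 0) x
  mem_dom_zero : x 0 ∈ dom φ
  step_le : ∀ k, P.t (k + 1) - P.t k ≤ δ
  energy_ge : ∀ k, P.t k ≤ T → -m ≤ energy φ (x k)
  dist_succ_lt : ∀ k, P.t (k + 1) ≤ T → dist (x k) (x (k + 1)) < r

lemma IsDiscreteSolution.isFineSolution {x₀ : X} (h : IsDiscreteSolution φ P x₀ x)
    (hbot : ∀ x, φ x ≠ ⊥) (hx₀ : x₀ ∈ dom φ) {δ m T r C : ℝ} (hP : P.mesh < ENNReal.ofReal δ)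
    (hC : energy φ x₀ ≤ C) (hm : ∀ k, P.t k ≤ T → -m ≤ energy φ (x k)) (hr : 0 < r)
    (hδ : 2 * δ * (C + m) < r ^ 2) : IsFineSolution φ P x δ m T r := by
  refine ⟨⟨rfl, h.2⟩, h.1.symm ▸ hx₀, fun k => (TimePartition.step_lt_of_mesh_lt hP k).le, hm,
    fun k hk => lt_of_pow_lt_pow_left₀ 2 hr.le (lt_of_le_of_lt ?_ hδ)⟩
  have hdrop : 0 ≤ energy φ (x k) - energy φ (x (k + 1)) :=
    sub_nonneg.2 (h.energy_antitone hbot hx₀ k.le_succ)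
  have hdrop_le : energy φ (x k) - energy φ (x (k + 1)) ≤ C + m := by
    linarith [h.energy_le hbot hx₀ k, hm _ hk]
  have hstep := (TimePartition.step_lt_of_mesh_lt hP k).le
  calc dist (x k) (x (k + 1)) ^ 2
      ≤ 2 * (P.t (k + 1) - P.t k) * (energy φ (x k) - energy φ (x (k + 1))) :=
        h.sq_dist_succ_le hbot hx₀ k
    _ ≤ 2 * δ * (C + m) := by
        have hδ0 := (P.step_pos k).le.trans hstep
        gcongr

namespace IsFineSolution

variable {l κ δ c m T r : ℝ} {i j : ℕ}

lemma sq_dist_le_gap (hx : IsFineSolution φ P x δ m T r) (hy : IsFineSolution φ Q y δ m T r)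
    (hc : 2 * δ ≤ c) (h : Linked P Q i j) (hi : P.t i ≤ T) (hj : Q.t j ≤ T) :
    dist (x i) (y j) ^ 2 ≤ gap φ P Q x y c m i j :=
  GradFlow.sq_dist_le_gap
    (abs_sub_le_iff.2 ⟨h.sub_le hx.step_le, h.symm.sub_le hy.step_le⟩) hc
    (hx.energy_ge i hi) (hy.energy_ge j hj)

lemma gap_succ_le (hx : IsFineSolution φ P x δ m T r) (hy : IsFineSolution φ Q y δ m T r)
    (hbot : ∀ x, φ x ≠ ⊥) (hevi : LocalEVI φ l κ r) (hl : 0 ≤ l) (hκ : 0 ≤ κ)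
    (hlδ : l * δ ≤ 1 / 2) (hc : 2 * (1 + κ) * δ ≤ c) (h : Linked P Q i j)
    (h' : Linked P Q (i + 1) j) (hi : P.t (i + 1) ≤ T) (hj : Q.t j ≤ T)
    (hd : dist (x i) (y j) < r) :
    gap φ P Q x y c m (i + 1) j ≤
      Real.exp (2 * (l * (P.t (i + 1) - P.t i))) * gap φ P Q x y c m i j := by
  have hsol := hx.isDiscreteSolution
  have hstep := P.step_pos i
  have hstepδ := hx.step_le i
  have hdrop : 0 ≤ energy φ (x i) - energy φ (x (i + 1)) :=
    sub_nonneg.2 (hsol.energy_antitone hbot hx.mem_dom_zero i.le_succ)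
  have hcδ : 2 * δ ≤ c := by linarith [mul_nonneg hκ (hstep.le.trans hstepδ)]
  have hgap := hx.sq_dist_le_gap hy hcδ h' hi hj
  refine le_exp_mul_of_le_add_mul (mul_nonneg hl hstep.le)
    ((mul_le_mul_of_nonneg_left hstepδ hl).trans hlδ) ((sq_nonneg _).trans hgap) ?_
  have hevi := hevi _ hstep (x i) (hsol.mem_dom hx.mem_dom_zero i) (x (i + 1)) (hsol.2 i) (y j)
    (hy.isDiscreteSolution.mem_dom hy.mem_dom_zero j) hd (hx.dist_succ_lt i hi)
  have hjump : κ * dist (x i) (x (i + 1)) ^ 2 ≤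
      κ * (2 * δ * (energy φ (x i) - energy φ (x (i + 1)))) := by
    gcongr
    exact (hsol.sq_dist_succ_le hbot hx.mem_dom_zero i).trans (by gcongr)
  have htime := mul_le_mul_of_nonneg_right (h.symm.sub_le hy.step_le) hdrop
  have hcdrop := mul_le_mul_of_nonneg_right hc hdrop
  have hlgap := mul_le_mul_of_nonneg_left hgap (mul_nonneg hl hstep.le)
  generalize hg : gap φ P Q x y c m (i + 1) j = g at *
  rw [gap] at hg ⊢
  linarith

lemma gap_le (hx : IsFineSolution φ P x δ m T r) (hy : IsFineSolution φ Q y δ m T r)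
    (hbot : ∀ x, φ x ≠ ⊥) (hevi : LocalEVI φ l κ r) (hl : 0 ≤ l) (hκ : 0 ≤ κ) (hr : 0 < r)
    (hlδ : l * δ ≤ 1 / 2) (hc : 2 * (1 + κ) * δ ≤ c)
    (hsmall : Real.exp (4 * l * T) * gap φ P Q x y c m 0 0 < r ^ 2) (h : Linked P Q i j)
    (hi : P.t i ≤ T) (hj : Q.t j ≤ T) :
    gap φ P Q x y c m i j ≤ Real.exp (2 * l * (P.t i + Q.t j)) * gap φ P Q x y c m 0 0 := by
  have hδ : 0 ≤ δ := (P.step_pos 0).le.trans (hx.step_le 0)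
  have hcδ : 2 * δ ≤ c := by linarith [mul_nonneg hκ hδ]
  have hT : 0 ≤ T := (P.t_nonneg i).trans hi
  have hgap0 : 0 ≤ gap φ P Q x y c m 0 0 := (sq_nonneg _).trans <|
    hx.sq_dist_le_gap hy hcδ (linked_zero P Q) (P.t_zero.trans_le hT) (Q.t_zero.trans_le hT)
  have hclose {i j : ℕ} (h : Linked P Q i j) (hi : P.t i ≤ T) (hj : Q.t j ≤ T)
      (hle : gap φ P Q x y c m i j ≤
        Real.exp (2 * l * (P.t i + Q.t j)) * gap φ P Q x y c m 0 0) : dist (x i) (y j) < r := by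
    refine lt_of_pow_lt_pow_left₀ 2 hr.le (lt_of_le_of_lt ?_ hsmall)
    refine (hx.sq_dist_le_gap hy hcδ h hi hj).trans (hle.trans ?_)
    have : 2 * l * (P.t i + Q.t j) ≤ 4 * l * T := by
      linarith [mul_le_mul_of_nonneg_left hi hl, mul_le_mul_of_nonneg_left hj hl]
    gcongr
  have hexp {a b : ℝ} {g : ℝ} (hg : g ≤ Real.exp a * gap φ P Q x y c m 0 0) :
      Real.exp b * g ≤ Real.exp (b + a) * gap φ P Q x y c m 0 0 := by
    rw [Real.exp_add, mul_assoc]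
    gcongr
  induction i, j, h using Linked.induction with
  | zero => simp [P.t_zero, Q.t_zero]
  | left i j h h' ih =>
    have hi' : P.t i ≤ T := (P.strictMono i.lt_succ_self).le.trans hi
    have hle := ih hi' hj
    refine (hx.gap_succ_le hy hbot hevi hl hκ hlδ hc h h' hi hj (hclose h hi' hj hle)).trans ?_
    exact (hexp hle).trans_eq (by ring_nf)
  | right i j h h' ih =>
    have hj' : Q.t j ≤ T := (Q.strictMono j.lt_succ_self).le.trans hj
    have hle := ih hi hj'
    rw [gap_comm φ P Q x y c m i]
    refine (hy.gap_succ_le hx hbot hevi hl hκ hlδ hc h.symm h'.symm hj hi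
      ((dist_comm _ _).trans_lt (hclose h hi hj' hle))).trans ?_
    rw [gap_comm φ Q P y x c m j]
    exact (hexp hle).trans_eq (by ring_nf)

lemma sq_dist_interp_le (hx : IsFineSolution φ P x δ m T r) (hy : IsFineSolution φ Q y δ m T r)
    (hbot : ∀ x, φ x ≠ ⊥) (hevi : LocalEVI φ l κ r) (hl : 0 ≤ l) (hκ : 0 ≤ κ) (hr : 0 < r)
    (hlδ : l * δ ≤ 1 / 2) (hc : 2 * (1 + κ) * δ ≤ c)
    (hsmall : Real.exp (4 * l * T) * gap φ P Q x y c m 0 0 < r ^ 2) {s : ℝ≥0}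
    (hP : P.t (P.index s) ≤ T) (hQ : Q.t (Q.index s) ≤ T) :
    dist (interp P x s) (interp Q y s) ^ 2 ≤
      Real.exp (4 * l * T) * gap φ P Q x y c m 0 0 := by
  have hδ : 0 ≤ δ := (P.step_pos 0).le.trans (hx.step_le 0)
  have hdist := hx.sq_dist_le_gap hy (c := c) (by linarith [mul_nonneg hκ hδ])
    (linked_index P Q s) hP hQ
  have hle := hx.gap_le hy hbot hevi hl hκ hr hlδ hc hsmall (linked_index P Q s) hP hQ
  have hgap0 : 0 ≤ gap φ P Q x y c m 0 0 :=
    nonneg_of_mul_nonneg_right ((sq_nonneg _).trans (hdist.trans hle)) (Real.exp_pos _)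
  refine (hdist.trans hle).trans ?_
  have : 2 * l * (P.t (P.index s) + Q.t (Q.index s)) ≤ 4 * l * T := by
    linarith [mul_le_mul_of_nonneg_left hP hl, mul_le_mul_of_nonneg_left hQ hl]
  gcongr

end IsFineSolution

lemma HasLocalEVI.exists_dist_interp_lt (hevi : HasLocalEVI φ) (hbot : ∀ x, φ x ≠ ⊥)
    (hcoer : IsCoercive φ) {y₀ : X} (hy₀ : y₀ ∈ dom φ) {C : ℝ} (hyC : energy φ y₀ ≤ C) (T : ℝ≥0)
    {ε : ℝ} (hε : 0 < ε) :
    ∃ δ : ℝ, 0 < δ ∧ ∀ (P Q : TimePartition) (x₀ : X) (x y : ℕ → X),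
      P.mesh < ENNReal.ofReal δ → Q.mesh < ENNReal.ofReal δ →
      IsDiscreteSolution φ P x₀ x → IsDiscreteSolution φ Q y₀ y →
      x₀ ∈ dom φ → energy φ x₀ ≤ C → dist x₀ y₀ < δ →
      ∀ s ≤ T, dist (interp P x s) (interp Q y s) < ε := by
  obtain ⟨l, κ, r, hl, hκ, hr, hevi⟩ := hevi
  obtain ⟨m, δ₁, hδ₁, hm⟩ := hcoer.exists_energy_ge hbot hy₀ C 1 (T + 1)
  set S := 1 + 4 * (1 + κ) * (C + m)
  set E := Real.exp (4 * l * (T + 1))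
  have hsmall (a : ℝ) {b : ℝ} (hb : 0 < b) : ∀ᶠ δ in 𝓝[>] (0 : ℝ), a * δ < b := by
    have hcont : Continuous fun δ : ℝ => a * δ := by fun_prop
    exact ((hcont.tendsto' 0 0 (mul_zero a)).mono_left nhdsWithin_le_nhds).eventually_lt_const hb
  obtain ⟨δ, ⟨hδ0, hδ1⟩, hδδ₁, hlδ, hSr, hESε, hESr⟩ := (eventually_nhdsGT_mem_Ioc.and <|
    (hsmall 1 hδ₁).and <| (hsmall l one_half_pos).and <| (hsmall S (pow_pos hr 2)).and <|
    (hsmall (E * S) (pow_pos hε 2)).and <| hsmall (E * S) (pow_pos hr 2)).exists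
  have hδδ₁ := ENNReal.ofReal_le_ofReal (one_mul δ ▸ hδδ₁.le)
  refine ⟨δ, hδ0, fun P Q x₀ x y hP hQ hx hy hx₀ hxC hxy s hs => ?_⟩
  have hxm := hm P x₀ x (hP.trans_le hδδ₁) hx hx₀ hxC
    ((dist_comm y₀ x₀).trans_le (hxy.le.trans hδ1))
  have hym := hm Q y₀ y (hQ.trans_le hδδ₁) hy hy₀ hyC ((dist_self y₀).trans_le zero_le_one)
  have hCm : 0 ≤ C + m := by
    linarith [hxm 0 (by rw [P.t_zero]; positivity), hx.energy_le hbot hx₀ 0]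
  have hjump : 2 * δ * (C + m) < r ^ 2 := by
    linarith [mul_nonneg hδ0.le hCm, mul_nonneg hκ (mul_nonneg hδ0.le hCm)]
  have hgap0 : E * gap φ P Q x y (2 * (1 + κ) * δ) m 0 0 ≤ E * S * δ := by
    rw [mul_assoc E S δ]
    exact mul_le_mul_of_nonneg_left (gap_zero_le hκ hδ1 (by rw [hx.1, hy.1]; exact hxy.le)
      (hx.1.symm ▸ hxC) (hy.1.symm ▸ hyC)) (Real.exp_pos _).le
  have hindex {P : TimePartition} (hP : P.mesh < ENNReal.ofReal δ) :
      P.t (P.index s) ≤ (T : ℝ) + 1 := by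
    linarith [TimePartition.t_index_lt hP s, NNReal.coe_le_coe.2 hs]
  refine lt_of_pow_lt_pow_left₀ 2 hε.le (lt_of_le_of_lt ?_ hESε)
  exact ((hx.isFineSolution hbot hx₀ hP hxC hxm hr hjump).sq_dist_interp_le
    (hy.isFineSolution hbot hy₀ hQ hyC hym hr hjump) hbot hevi hl hκ hr hlδ.le le_rfl
    (hgap0.trans_lt hESr) (hindex hP) (hindex hQ)).trans hgap0

end Stability

/-! ### Limit curves -/

section Limits

variable {X : Type*} [MetricSpace X]

/-- The filter of discrete solutions from `x₀` along meshes tending to zero. A single filter of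
pairs (partition, solution) takes the place of all sequences of discrete solutions. -/
def solutionFilter (φ : X → EReal) (x₀ : X) : Filter (TimePartition × (ℕ → X)) :=
  comap (fun p => p.1.mesh) (𝓝 0) ⊓ 𝓟 {p | IsDiscreteSolution φ p.1 x₀ p.2}

instance (φ : X → EReal) (x₀ : X) : (solutionFilter φ x₀).IsCountablyGenerated :=
  inferInstanceAs (IsCountablyGenerated (_ ⊓ _))

variable {φ : X → EReal} {x₀ : X} {ξ : ℝ≥0 → X}

lemma tendsto_solutionFilter_iff {ι : Type*} {l : Filter ι} {p : ι → TimePartition × (ℕ → X)} :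
    Tendsto p l (solutionFilter φ x₀) ↔ Tendsto (fun i => (p i).1.mesh) l (𝓝 0) ∧
      ∀ᶠ i in l, IsDiscreteSolution φ (p i).1 x₀ (p i).2 := by
  rw [solutionFilter, tendsto_inf, tendsto_comap_iff, tendsto_principal]
  rfl

lemma eventually_isDiscreteSolution (φ : X → EReal) (x₀ : X) :
    ∀ᶠ p in solutionFilter φ x₀, IsDiscreteSolution φ p.1 x₀ p.2 :=
  (tendsto_solutionFilter_iff.1 tendsto_id).2

lemma eventually_mesh_lt (φ : X → EReal) (x₀ : X) {δ : ℝ} (hδ : 0 < δ) :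
    ∀ᶠ p in solutionFilter φ x₀, p.1.mesh < ENNReal.ofReal δ :=
  (tendsto_solutionFilter_iff.1 tendsto_id).1.eventually_lt_const (ENNReal.ofReal_pos.2 hδ)

lemma isLimitCurve_iff_tendstoUniformlyOn : IsLimitCurve φ x₀ ξ ↔ ξ 0 = x₀ ∧
    ∀ T : ℝ≥0, TendstoUniformlyOn (fun p => interp p.1 p.2) ξ (solutionFilter φ x₀) (Icc 0 T) := by
  refine and_congr_right fun _ => ⟨fun h T => ?_, fun h P x hP hx T u hu => ?_⟩
  · by_contra hT
    obtain ⟨u, hu, hT⟩ : ∃ u ∈ uniformity X, ∃ᶠ p in solutionFilter φ x₀,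
        ¬ ∀ s ∈ Icc 0 T, (ξ s, interp p.1 p.2 s) ∈ u := by
      simpa only [TendstoUniformlyOn, not_forall, not_eventually, exists_prop] using hT
    obtain ⟨p, hp, hbad⟩ := exists_seq_forall_of_frequently
      (hT.and_eventually (eventually_isDiscreteSolution φ x₀))
    obtain ⟨n, hn⟩ := (h (fun n => (p n).1) (fun n => (p n).2) (tendsto_solutionFilter_iff.1 hp).1
      (fun n => (hbad n).2) T u hu).exists
    exact (hbad n).1 hn
  · have hp : Tendsto (fun i => (P i, x i)) atTop (solutionFilter φ x₀) :=
      tendsto_solutionFilter_iff.2 ⟨hP, Eventually.of_forall hx⟩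
    exact hp.eventually (h T u hu)

lemma IsLimitCurve.tendsto_interp (hξ : IsLimitCurve φ x₀ ξ) (s : ℝ≥0) :
    Tendsto (fun p => interp p.1 p.2 s) (solutionFilter φ x₀) (𝓝 (ξ s)) :=
  ((isLimitCurve_iff_tendstoUniformlyOn.1 hξ).2 s).tendsto_at (right_mem_Icc.2 zero_le)

namespace TimePartition

/-- The partition with equidistant nodes. -/
def uniform (h : ℝ) (hh : 0 < h) : TimePartition where
  t k := k * h
  t_zero := by simp
  strictMono _ _ hab := mul_lt_mul_of_pos_right (Nat.cast_lt.2 hab) hh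
  tendsto := tendsto_natCast_atTop_atTop.atTop_mul_const hh

lemma mesh_uniform (h : ℝ) (hh : 0 < h) : (uniform h hh).mesh = ENNReal.ofReal h := by
  simp only [mesh, uniform, Nat.cast_add_one, add_one_mul, add_sub_cancel_left, ciSup_const]

lemma exists_mesh_lt_and_t_eq (s : ℝ≥0) {δ : ℝ≥0∞} (hδ : 0 < δ) :
    ∃ P : TimePartition, P.mesh < δ ∧ ∃ k, P.t k = s := by
  obtain ⟨h, hh, hhδ⟩ := ENNReal.lt_iff_exists_nnreal_btwn.1 hδ
  replace hh : 0 < (h : ℝ) := NNReal.coe_pos.2 (ENNReal.coe_pos.1 hh)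
  rcases eq_or_ne s 0 with rfl | hs
  · exact ⟨uniform h hh, by rwa [mesh_uniform, ENNReal.ofReal_coe_nnreal], 0, t_zero _⟩
  · replace hs : 0 < (s : ℝ) := NNReal.coe_pos.2 (pos_iff_ne_zero.2 hs)
    obtain ⟨n, hn⟩ := exists_nat_gt ((s : ℝ) / h)
    have hn0 : 0 < (n : ℝ) := (div_pos hs hh).trans hn
    refine ⟨uniform (s / n) (div_pos hs hn0), ?_, n, mul_div_cancel₀ _ hn0.ne'⟩
    rw [mesh_uniform]
    refine lt_of_le_of_lt ?_ hhδ
    rw [← ENNReal.ofReal_coe_nnreal]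
    exact ENNReal.ofReal_le_ofReal ((div_lt_comm₀ hh hn0).1 hn).le

/-- The partition of `[t k, ∞)` induced by `P`, translated to start at `0`. -/
def shift (P : TimePartition) (k : ℕ) : TimePartition where
  t j := P.t (k + j) - P.t k
  t_zero := sub_self _
  strictMono _ _ hij := sub_lt_sub_right (P.strictMono (Nat.add_lt_add_left hij k)) _
  tendsto := tendsto_atTop_add_const_right _ _
    (P.tendsto.comp (tendsto_atTop_mono (Nat.le_add_left · k) tendsto_id))

lemma shift_step (P : TimePartition) (k j : ℕ) :
    (P.shift k).t (j + 1) - (P.shift k).t j = P.t (k + j + 1) - P.t (k + j) :=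
  sub_sub_sub_cancel_right _ _ _

lemma mesh_shift_le (P : TimePartition) (k : ℕ) : (P.shift k).mesh ≤ P.mesh :=
  iSup_le fun j => by
    rw [shift_step]
    exact le_iSup (fun i => ENNReal.ofReal (P.t (i + 1) - P.t i)) (k + j)

lemma index_add {P : TimePartition} {k : ℕ} {s : ℝ≥0} (hk : P.t k = s) (t : ℝ≥0) :
    P.index (s + t) = k + (P.shift k).index t := by
  have hkle : k ≤ P.index (s + t) := P.strictMono.le_iff_le.1 <|
    hk.trans_le ((NNReal.coe_le_coe.2 le_self_add).trans (P.le_t_index (s + t)))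
  obtain ⟨j, hj⟩ := Nat.exists_eq_add_of_le hkle
  apply le_antisymm
  · have := le_sub_iff_add_le'.1 ((P.shift k).le_t_index t)
    rw [hk] at this
    exact index_le_iff.2 this
  · rw [hj, Nat.add_le_add_iff_left, index_le_iff]
    have := P.le_t_index (s + t)
    rw [hj, NNReal.coe_add] at this
    exact le_sub_iff_add_le'.2 (hk ▸ this)

end TimePartition

lemma interp_add {Y : Type*} {P : TimePartition} {k : ℕ} {s : ℝ≥0} (hk : P.t k = s) (x : ℕ → Y)
    (t : ℝ≥0) :
    interp P x (s + t) = interp (P.shift k) (fun j => x (k + j)) t :=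
  congrArg x (TimePartition.index_add hk t)

lemma interp_zero {Y : Type*} (P : TimePartition) (x : ℕ → Y) : interp P x 0 = x 0 :=
  congrArg x P.index_zero

lemma IsDiscreteSolution.shift {P : TimePartition} {x : ℕ → X} (h : IsDiscreteSolution φ P x₀ x)
    (k : ℕ) : IsDiscreteSolution φ (P.shift k) (x k) fun j => x (k + j) :=
  ⟨rfl, fun j => by rw [TimePartition.shift_step]; exact h.2 (k + j)⟩

lemma IsCoercive.frequently_exists_t_eq (h : IsCoercive φ) (x₀ : X) (s : ℝ≥0) :
    ∃ᶠ p in solutionFilter φ x₀, ∃ k, p.1.t k = (s : ℝ) := by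
  obtain ⟨δ, hδ, hex⟩ := h.exists_isDiscreteSolution
  refine ((ENNReal.nhds_zero_basis.comap _).inf_principal _).frequently_iff.2 fun {ε} hε => ?_
  obtain ⟨P, hP, hk⟩ :=
    TimePartition.exists_mesh_lt_and_t_eq s (lt_min hε (ENNReal.ofReal_pos.2 hδ))
  obtain ⟨x, hx⟩ := hex P (hP.trans_le (min_le_right _ _)) x₀
  exact ⟨(P, x), ⟨hP.trans_le (min_le_left _ _), hx⟩, hk⟩

lemma IsCoercive.neBot_solutionFilter (h : IsCoercive φ) (x₀ : X) : (solutionFilter φ x₀).NeBot :=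
  (frequently_true_iff_neBot _).1 ((h.frequently_exists_t_eq x₀ 0).mono fun _ _ => trivial)

namespace IsLimitCurve

lemma unique (hcoer : IsCoercive φ) {ζ : ℝ≥0 → X} (hξ : IsLimitCurve φ x₀ ξ)
    (hζ : IsLimitCurve φ x₀ ζ) : ξ = ζ :=
  have := hcoer.neBot_solutionFilter x₀
  funext fun s => tendsto_nhds_unique (hξ.tendsto_interp s) (hζ.tendsto_interp s)

lemma mem_dom_and_energy_le (hξ : IsLimitCurve φ x₀ ξ) (hbot : ∀ x, φ x ≠ ⊥)
    (hlsc : LowerSemicontinuous φ) (hcoer : IsCoercive φ) (hx₀ : x₀ ∈ dom φ) (s : ℝ≥0) :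
    ξ s ∈ dom φ ∧ energy φ (ξ s) ≤ energy φ x₀ := by
  have := hcoer.neBot_solutionFilter x₀
  have hclosed := isClosed_setOf_energy_add_le hbot hlsc (continuous_const (y := (0 : ℝ)))
    (energy φ x₀)
  simp only [add_zero] at hclosed
  refine hclosed.mem_of_tendsto (hξ.tendsto_interp s) ?_
  filter_upwards [eventually_isDiscreteSolution φ x₀] with p hp
  exact ⟨hp.mem_dom hx₀ _, hp.energy_le hbot hx₀ _⟩

lemma exists_sq_dist_le (hξ : IsLimitCurve φ x₀ ξ) (hbot : ∀ x, φ x ≠ ⊥) (hcoer : IsCoercive φ)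
    (hx₀ : x₀ ∈ dom φ) (T : ℝ≥0) :
    ∃ B : ℝ, ∀ a b : ℝ≥0, a ≤ b → b ≤ T → dist (ξ a) (ξ b) ^ 2 ≤ B * dist a b := by
  have := hcoer.neBot_solutionFilter x₀
  obtain ⟨m, δ₀, hδ₀, hm⟩ := hcoer.exists_energy_ge hbot hx₀ (energy φ x₀) 0 (T + 1)
  refine ⟨2 * (energy φ x₀ + m), fun a b hab hbT => ?_⟩
  have hdist : dist a b = b - a := by
    rw [NNReal.dist_eq, abs_sub_comm, abs_of_nonneg (sub_nonneg.2 (NNReal.coe_le_coe.2 hab))]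
  have hbound : ∀ᶠ δ in 𝓝[>] (0 : ℝ),
      dist (ξ a) (ξ b) ^ 2 ≤ 2 * (energy φ x₀ + m) * (dist a b + δ) := by
    filter_upwards [eventually_nhdsGT_mem_Ioc, Ioo_mem_nhdsGT hδ₀] with δ hδ1 hδδ₀
    refine le_of_tendsto (((hξ.tendsto_interp a).dist (hξ.tendsto_interp b)).pow 2) ?_
    filter_upwards [eventually_isDiscreteSolution φ x₀, eventually_mesh_lt φ x₀ hδ1.1]
      with ⟨P, x⟩ hx hP
    have htime := TimePartition.t_index_lt hP b
    have henergy : -m ≤ energy φ (x (P.index b)) :=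
      hm P x₀ x (hP.trans_le (ENNReal.ofReal_le_ofReal hδδ₀.2.le)) hx hx₀ le_rfl
        (dist_self x₀).le _ (by linarith [hδ1.2, NNReal.coe_le_coe.2 hbT])
    have hindex := P.index_mono hab
    calc dist (interp P x a) (interp P x b) ^ 2
        ≤ 2 * (P.t (P.index b) - P.t (P.index a)) *
          (energy φ (x (P.index a)) - energy φ (x (P.index b))) := hx.sq_dist_le hbot hx₀ hindex
      _ ≤ 2 * (dist a b + δ) * (energy φ x₀ + m) := by
        have hdecr := sub_nonneg.2 (hx.energy_antitone hbot hx₀ hindex)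
        gcongr
        · linarith [hδ1.1, dist_nonneg (x := a) (y := b)]
        · linarith [P.le_t_index a]
        · linarith [hx.energy_le hbot hx₀ (P.index a)]
      _ = 2 * (energy φ x₀ + m) * (dist a b + δ) := by ring
  have hcont : Continuous fun δ : ℝ => 2 * (energy φ x₀ + m) * (dist a b + δ) := by fun_prop
  exact ge_of_tendsto ((hcont.tendsto' 0 _ (by rw [add_zero])).mono_left nhdsWithin_le_nhds) hbound

lemma continuous (hξ : IsLimitCurve φ x₀ ξ) (hbot : ∀ x, φ x ≠ ⊥) (hcoer : IsCoercive φ)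
    (hx₀ : x₀ ∈ dom φ) : Continuous ξ := by
  refine continuous_iff_continuousAt.2 fun t => tendsto_iff_dist_tendsto_zero.2 ?_
  obtain ⟨B, hB⟩ := hξ.exists_sq_dist_le hbot hcoer hx₀ (t + 1)
  have hsqrt : Continuous fun s : ℝ≥0 => √(B * dist s t) := by fun_prop
  refine squeeze_zero' (Eventually.of_forall fun _ => dist_nonneg) ?_
    (hsqrt.tendsto' t 0 (by simp))
  filter_upwards [eventually_lt_nhds (lt_add_of_pos_right t one_pos)] with s hs
  refine Real.le_sqrt_of_sq_le ?_
  rcases le_total s t with hst | hst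
  · exact hB s t hst (le_add_of_nonneg_right zero_le_one)
  · rw [dist_comm (ξ s), dist_comm s]
    exact hB t s hst hs.le

end IsLimitCurve

namespace HasLocalEVI

lemma uniformCauchySeqOn_interp (hevi : HasLocalEVI φ) (hbot : ∀ x, φ x ≠ ⊥)
    (hcoer : IsCoercive φ) (hx₀ : x₀ ∈ dom φ) (T : ℝ≥0) :
    UniformCauchySeqOn (fun p => interp p.1 p.2) (solutionFilter φ x₀) (Icc 0 T) := by
  intro u hu
  obtain ⟨ε, hε, hεu⟩ := Metric.mem_uniformity_dist.1 hu
  obtain ⟨δ, hδ, hdist⟩ := hevi.exists_dist_interp_lt hbot hcoer hx₀ le_rfl T hε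
  have hfine := (eventually_mesh_lt φ x₀ hδ).and (eventually_isDiscreteSolution φ x₀)
  filter_upwards [hfine.prod_mk hfine] with p ⟨⟨hP, hx⟩, hQ, hy⟩ s hs
  exact hεu (hdist _ _ _ _ _ hP hQ hx hy hx₀ le_rfl ((dist_self x₀).trans_lt hδ) s hs.2)

lemma exists_isLimitCurve [CompleteSpace X] (hevi : HasLocalEVI φ) (hbot : ∀ x, φ x ≠ ⊥)
    (hcoer : IsCoercive φ) (hx₀ : x₀ ∈ dom φ) : ∃ ξ : ℝ≥0 → X, IsLimitCurve φ x₀ ξ := by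
  have := hcoer.neBot_solutionFilter x₀
  have hcauchy := hevi.uniformCauchySeqOn_interp hbot hcoer hx₀
  choose ξ hξ using fun s =>
    cauchy_map_iff_exists_tendsto.1 ((hcauchy s).cauchy_map (right_mem_Icc.2 zero_le))
  refine ⟨ξ, isLimitCurve_iff_tendstoUniformlyOn.2 ⟨tendsto_nhds_unique (hξ 0) ?_, fun T =>
    (hcauchy T).tendstoUniformlyOn_of_tendsto fun s _ => hξ s⟩⟩
  refine tendsto_const_nhds.congr' ?_
  filter_upwards [eventually_isDiscreteSolution φ x₀] with p hp
  rw [interp_zero, hp.1]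

lemma limitCurve_add (hevi : HasLocalEVI φ) (hbot : ∀ x, φ x ≠ ⊥) (hlsc : LowerSemicontinuous φ)
    (hcoer : IsCoercive φ) (hx₀ : x₀ ∈ dom φ) (hξ : IsLimitCurve φ x₀ ξ) (s : ℝ≥0) {ζ : ℝ≥0 → X}
    (hζ : IsLimitCurve φ (ξ s) ζ) (t : ℝ≥0) : ζ t = ξ (s + t) := by
  have := hcoer.neBot_solutionFilter (ξ s)
  obtain ⟨hdom, henergy⟩ := hξ.mem_dom_and_energy_le hbot hlsc hcoer hx₀ s
  refine dist_le_zero.1 (le_of_forall_pos_le_add fun ε hε => ?_)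
  obtain ⟨δ, hδ, hdist⟩ :=
    hevi.exists_dist_interp_lt hbot hcoer hdom henergy t (ε := ε / 3) (by positivity)
  obtain ⟨⟨P, x⟩, ⟨k, hk⟩, hx, hP, hξs, hξst⟩ := (hcoer.frequently_exists_t_eq x₀ s).and_eventually
    ((eventually_isDiscreteSolution φ x₀).and <| (eventually_mesh_lt φ x₀ hδ).and <|
      ((hξ.tendsto_interp s).eventually (Metric.ball_mem_nhds _ hδ)).and <|
      (hξ.tendsto_interp (s + t)).eventually
        (Metric.ball_mem_nhds _ (show 0 < ε / 3 by positivity))) |>.exists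
  obtain ⟨⟨Q, y⟩, hy, hQ, hζt⟩ := ((eventually_isDiscreteSolution φ (ξ s)).and <|
    (eventually_mesh_lt φ (ξ s) hδ).and <| (hζ.tendsto_interp t).eventually
      (Metric.ball_mem_nhds _ (show 0 < ε / 3 by positivity))).exists
  have hstart : dist (x k) (ξ s) < δ := by
    have hinterp : interp P x s = x k := by
      simpa only [add_zero, interp_zero] using interp_add hk x 0
    rw [← hinterp]
    exact hξs
  have hclose : dist (interp P x (s + t)) (interp Q y t) < ε / 3 := by
    rw [interp_add hk]
    exact hdist _ _ _ _ _ ((P.mesh_shift_le k).trans_lt hP) hQ (hx.shift k) hy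
      (hx.mem_dom hx₀ k) (hx.energy_le hbot hx₀ k) hstart t le_rfl
  calc dist (ζ t) (ξ (s + t)) ≤ dist (ζ t) (interp Q y t) + dist (interp Q y t)
        (interp P x (s + t)) + dist (interp P x (s + t)) (ξ (s + t)) := dist_triangle4 _ _ _ _
    _ ≤ ε / 3 + ε / 3 + ε / 3 :=
        add_le_add_three (Metric.mem_ball'.1 hζt).le ((dist_comm _ _).trans_le hclose.le) hξst.le
    _ = 0 + ε := by ring

end HasLocalEVI

end Limits

theorem isCoercive_of_cases {X : Type*} [MetricSpace X] [CompleteSpace X] {φ : X → EReal}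
    {lam : ℝ} (hbot : ∀ x, φ x ≠ ⊥) (hdom : (dom φ).Nonempty) (hlsc : LowerSemicontinuous φ)
    (h : CaseI φ lam ∨ CaseII φ lam) : IsCoercive φ := by
  rcases h with ⟨hX, hφ, hdiam | hcoer⟩ | h
  · exact hX.isCoercive hbot hdom hlsc hφ hdiam
  · exact hcoer
  · exact h.1

theorem hasLocalEVI_of_cases {X : Type*} [MetricSpace X] {φ : X → EReal} {lam : ℝ}
    (hbot : ∀ x, φ x ≠ ⊥) (h : CaseI φ lam ∨ CaseII φ lam) : HasLocalEVI φ :=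
  h.elim (fun h => h.1.hasLocalEVI hbot h.2.1) fun h => h.hasLocalEVI hbot

end GradFlow

end

theorem theorem4p2_general {X : Type*} [MetricSpace X] [CompleteSpace X] {φ : X → EReal}
    (hbot : ∀ x, φ x ≠ ⊥) (hlsc : LowerSemicontinuous φ) (hcoer : GradFlow.IsCoercive φ)
    (hevi : GradFlow.HasLocalEVI φ) :
    (∃ δ : ℝ≥0∞, 0 < δ ∧ ∀ P : GradFlow.TimePartition, P.mesh < δ → ∀ x₀ ∈ GradFlow.dom φ,
      ∃ x : ℕ → X, GradFlow.IsDiscreteSolution φ P x₀ x) ∧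
    (∀ x₀ ∈ GradFlow.dom φ, ∃! ξ : ℝ≥0 → X, GradFlow.IsLimitCurve φ x₀ ξ) ∧
    (∃ G : ℝ≥0 → GradFlow.dom φ → GradFlow.dom φ,
      (∀ x₀ : GradFlow.dom φ, GradFlow.IsLimitCurve φ (x₀ : X) (fun t => (G t x₀ : X))) ∧
      (∀ x₀ : GradFlow.dom φ, Continuous (fun t => G t x₀)) ∧
      (∀ x₀ : GradFlow.dom φ, G 0 x₀ = x₀) ∧
      (∀ (s t : ℝ≥0) (x₀ : GradFlow.dom φ), G t (G s x₀) = G (s + t) x₀)) := by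
  refine ⟨?_, fun x₀ hx₀ => ?_, ?_⟩
  · obtain ⟨δ, hδ, hex⟩ := hcoer.exists_isDiscreteSolution
    exact ⟨ENNReal.ofReal δ, ENNReal.ofReal_pos.2 hδ, fun P hP x₀ _ => hex P hP x₀⟩
  · obtain ⟨ξ, hξ⟩ := hevi.exists_isLimitCurve hbot hcoer hx₀
    exact ⟨ξ, hξ, fun ζ hζ => hζ.unique hcoer hξ⟩
  · choose ξ hξ using fun x₀ : GradFlow.dom φ => hevi.exists_isLimitCurve hbot hcoer x₀.2
    have hmem (t : ℝ≥0) (x₀ : GradFlow.dom φ) : ξ x₀ t ∈ GradFlow.dom φ :=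
      ((hξ x₀).mem_dom_and_energy_le hbot hlsc hcoer x₀.2 t).1
    exact ⟨fun t x₀ => ⟨ξ x₀ t, hmem t x₀⟩, hξ,
      fun x₀ => ((hξ x₀).continuous hbot hcoer x₀.2).subtype_mk _,
      fun x₀ => Subtype.ext (hξ x₀).1,
      fun s t x₀ => Subtype.ext
        (hevi.limitCurve_add hbot hlsc hcoer x₀.2 (hξ x₀) s (hξ ⟨ξ x₀ s, hmem s x₀⟩) t)⟩

theorem theorem4p2 {X : Type*} [MetricSpace X] [CompleteSpace X]
    (φ : X → EReal) (lam : ℝ)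
    (hbot : ∀ x, φ x ≠ ⊥) (hdom : (GradFlow.dom φ).Nonempty)
    (hlsc : LowerSemicontinuous φ)
    (hcase : GradFlow.CaseI φ lam ∨ GradFlow.CaseII φ lam) :
    -- discrete solutions exist for all sufficiently fine partitions
    (∃ δ : ℝ≥0∞, 0 < δ ∧ ∀ P : GradFlow.TimePartition, P.mesh < δ → ∀ x₀ ∈ GradFlow.dom φ,
      ∃ x : ℕ → X, GradFlow.IsDiscreteSolution φ P x₀ x) ∧
    -- they converge locally uniformly to one and the same curve
    (∀ x₀ ∈ GradFlow.dom φ, ∃! ξ : ℝ≥0 → X, GradFlow.IsLimitCurve φ x₀ ξ) ∧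
    -- the limit curves are continuous, stay in the domain and form a semigroup
    (∃ G : ℝ≥0 → GradFlow.dom φ → GradFlow.dom φ,
      (∀ x₀ : GradFlow.dom φ, GradFlow.IsLimitCurve φ (x₀ : X) (fun t => (G t x₀ : X))) ∧
      (∀ x₀ : GradFlow.dom φ, Continuous (fun t => G t x₀)) ∧
      (∀ x₀ : GradFlow.dom φ, G 0 x₀ = x₀) ∧
      (∀ (s t : ℝ≥0) (x₀ : GradFlow.dom φ), G t (G s x₀) = G (s + t) x₀)) :=
  theorem4p2_general hbot hlsc (GradFlow.isCoercive_of_cases hbot hdom hlsc hcase)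
    (GradFlow.hasLocalEVI_of_cases hbot hcase)
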